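/- **Theorem (abstract Fujita approximation for graded algebras).** Let $\mathbf k\subset F$ be a field extension of finite transcendence degree $n$, and let $v:F\setminus\{0\}\to\mathbb Z^n$ be a valuation over $\mathbf k$ (where $\mathbb Z^n$ carries some total order compatible with addition) which is faithful, i.e. surjective onto $\mathbb Z^n$, and has one-dimensional leaves, i.e. for every $\alpha\in\mathbb Z^n$ the quotient $\{v\ge\alpha\}/\{v>\alpha\}$ has dimension at most $1$ over $\mathbf k$. For $0\ne P=a_it^i+\dots+a_0\in F[t]$ with $a_i\neq 0$ put $v_t(P)=(v(a_i),i)\in\mathbb Z^n\times\mathbb Z$. For a graded $\mathbf k$-subalgebra $A=\bigoplus_{i\ge 0}A_i\subset F[t]$ put $H_A(i)=\dim_{\mathbf k}A_i$ and $S(A)=v_t(A\setminus\{0\})$. Let $\pi:\mathbb R^n\times\mathbb R\to\mathbb R$ be the projection to the last factor, $L(A)$ the real span of $S(A)$, $\mathrm{Con}(A)$ the closure of the set of all linear combinations of elements of $S(A)$ with non-negative real coefficients, $G(A)$ the group generated by $S(A)$, and $G_0(A)=G(A)\cap\pi^{-1}(0)$. Let $m(A)$ be the index of $\pi(G(A))$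 in $\mathbb Z$, let $\mathrm{ind}(A)$ be the index of $G_0(A)$ in $L(A)\cap(\mathbb Z^n\times\{0\})$, and let $\Delta(A)=\mathrm{Con}(A)\cap\pi^{-1}(m(A))$. For a convex set $D$ of dimension $q$ with rational affine hull, $\mathrm{Vol}_q(D)$ denotes the $q$-dimensional volume on this affine hull, normalized so that a fundamental parallelepiped of the lattice of integral points in the linear space parallel to it has volume $1$. For a non-zero finite dimensional $\mathbf k$-subspace $L\subset F$ let $A_L=\bigoplus_{i\ge0}L^it^i$, where $L^0=\mathbf k$ and $L^i$ is the span of all products of $i$ elements of $L$. A graded subalgebra of $F[t]$ is of integral type if it is a finitely generated module over some $A_L$, and of almost integral type if it is contained in a graded subalgebra of integral type. Let $A\subset F[t]$ be a graded subalgebra of almost integral type with $A_i\ne 0$ for some $i>0$; put $m=m(A)$ and $q=\dim\Delta(A)$, and for $p\geq 0$ let $\widehat A_p$ be the $\mathbf k$-subalgebra of $F[t]$ generated by $A_p$. Then $\mathrm{Vol}_q(\Delta(A))$ and $\mathrm{ind}(A)$ are finite, and for all sufficiently large $p$ divisible by $m$ we have $A_p\neq 0$ and: 1. $\dim\Delta(\widehat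 A_p)=\dim\Delta(A)=q$. 2. $\mathrm{ind}(\widehat A_p)=\mathrm{ind}(A)$. 3. The limit $\varphi(p)=\lim_{t\to\infty}H_{\widehat A_p}(tp)/t^q$ exists and is finite. Moreover $$\lim_{k\to\infty}\frac{\varphi(mk)}{k^q}=\lim_{k\to\infty}\frac{H_A(mk)}{k^q}=\frac{\mathrm{Vol}_q(\Delta(A))}{\mathrm{ind}(A)},$$ where both limits exist. -/

import Mathlib

open Filter Topology MeasureTheory
open scoped NNReal ENNReal

noncomputable section

namespace NewtonOkounkov

/-! ### Semigroups of integral points in `ℝⁿ × ℝ`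

All notions below are meant for a semigroup `S ⊆ ℤⁿ × ℤ`; they only use its underlying set. -/

/-- The lattice `ℤⁿ × ℤ`. -/
abbrev Lat (n : ℕ) : Type := (Fin n → ℤ) × ℤ

/-- The real space `ℝⁿ × ℝ`. -/
abbrev Space (n : ℕ) : Type := (Fin n → ℝ) × ℝ

/-- The inclusion `ℤⁿ × ℤ → ℝⁿ × ℝ`. -/
def latIncl (n : ℕ) : Lat n →+ Space n where
  toFun z := (fun i => (z.1 i : ℝ), (z.2 : ℝ))
  map_zero' := by ext <;> simp
  map_add' x y := by ext <;> simp

variable {n : ℕ}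

/-- `L(S)`, the real span of `S`. -/
def realSpan (S : Set (Lat n)) : Submodule ℝ (Space n) :=
  Submodule.span ℝ (latIncl n '' S)

/-- `Con(S)`, the closure of the set of all linear combinations of elements of `S` with
non-negative real coefficients. -/
def cone (S : Set (Lat n)) : Set (Space n) :=
  closure (Submodule.span ℝ≥0 (latIncl n '' S) : Set (Space n))

/-- `G(S)`, the group generated by `S`. -/
def group (S : Set (Lat n)) : AddSubgroup (Lat n) := AddSubgroup.closure S

/-- `G₀(S)`, the elements of `G(S)` whose last coordinate is zero. -/
def group₀ (S : Set (Lat n)) : AddSubgroup (Lat n) :=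
  group S ⊓ (AddMonoidHom.snd (Fin n → ℤ) ℤ).ker

/-- The lattice of integral points of `∂M(S) = L(S) ∩ (ℝⁿ × {0})`. -/
def boundaryLattice (S : Set (Lat n)) : AddSubgroup (Lat n) :=
  (realSpan S).toAddSubgroup.comap (latIncl n) ⊓ (AddMonoidHom.snd (Fin n → ℤ) ℤ).ker

/-- `ind(S)`, the index of `G₀(S)` in the lattice of integral points of `∂M(S)`. -/
def ind (S : Set (Lat n)) : ℕ := (group₀ S).relIndex (boundaryLattice S)

/-- `m(S)`, the index in `ℤ` of the projection of `G(S)` to the last coordinate. -/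
def levelIndex (S : Set (Lat n)) : ℕ :=
  ((group S).map (AddMonoidHom.snd (Fin n → ℤ) ℤ)).index

/-- The Newton-Okounkov convex set `Δ(S)`: the section of `Con(S)` at level `m(S)`. -/
def body (S : Set (Lat n)) : Set (Space n) :=
  {x | x ∈ cone S ∧ x.2 = (levelIndex S : ℝ)}

/-- The dimension of a convex set: the dimension of its affine hull. -/
def convexDim (D : Set (Space n)) : ℕ := Module.finrank ℝ (vectorSpan ℝ D)

/-! ### Integral volume -/

/-- The integral points of a linear subspace `L`. -/
def integralPoints (L : Submodule ℝ (Space n)) : Submodule ℤ L :=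
  AddSubgroup.toIntSubmodule ((latIncl n).range.comap L.subtype.toAddMonoidHom)

/-- The integral measure on a rational linear subspace `L`: the translation invariant measure for
which the fundamental parallelepipeds of the lattice of integral points of `L` (that is, the
smallest parallelepipeds of full dimension with integral vertices) have measure `1`. -/
def integralMeasure (L : Submodule ℝ (Space n)) : Measure L :=
  (ENNReal.ofReal (ZLattice.covolume (integralPoints L) Measure.addHaar))⁻¹ • Measure.addHaar

/-- The integral volume of a subset `D` of an affine subspace parallel to `L`: the integral measure
of `D - x` for `x ∈ D`. It does not depend on the choice of `x`, so that the
supremum is over a constant (and is `0` if `D` is empty). -/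
def integralVolume (L : Submodule ℝ (Space n)) (D : Set (Space n)) : ℝ≥0∞ :=
  ⨆ x ∈ D, integralMeasure L {y : L | x + (y : Space n) ∈ D}

/-- `Vol_q(D)` for a convex set `D` of dimension `q` with rational affine hull: the integral volume
of `D` in its (`q`-dimensional) affine hull. -/
def bodyVolume (D : Set (Space n)) : ℝ≥0∞ := integralVolume (vectorSpan ℝ D) D

/-! ### Growth coefficients -/

/-- `a` is the `q`-th growth coefficient of `f`, i.e. the limit of `f k / k ^ q`. -/
def HasGrowthCoeff (q : ℕ) (f : ℕ → ℝ≥0∞) (a : ℝ≥0∞) : Prop :=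
  Tendsto (fun k : ℕ => f k / (k : ℝ≥0∞) ^ q) atTop (𝓝 a)

/-! ### Graded subalgebras of `F[t]` -/

section Algebras

variable {k F : Type*} [Field k] [Field F] [Algebra k F]

/-- The homogeneous component of degree `i`: the elements of `A` of the form `a tⁱ`, `a ∈ F`. -/
def component (A : Subalgebra k (Polynomial F)) (i : ℕ) : Submodule k (Polynomial F) :=
  Subalgebra.toSubmodule A ⊓
    LinearMap.range ((Polynomial.monomial i : F →ₗ[F] Polynomial F).restrictScalars k)

/-- `A` is graded: it contains the homogeneous parts of each of its elements. -/
def IsGraded (A : Subalgebra k (Polynomial F)) : Prop :=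
  ∀ f ∈ A, ∀ i : ℕ, Polynomial.monomial i (f.coeff i) ∈ A

/-- The Hilbert function `H_A(i) = dim_k A_i`, equal to `∞` when `A_i` is infinite dimensional. -/
def hilbert (A : Subalgebra k (Polynomial F)) (i : ℕ) : ℕ∞ :=
  Cardinal.toENat (Module.rank k (component A i))

/-- The algebra `A_L = ⨁ Lⁱ tⁱ` of a subspace `L ⊆ F`; here `L ^ i` is the span of all products of
`i` elements of `L`, and `L ^ 0 = k`. -/
def algebraOf (L : Submodule k F) : Subalgebra k (Polynomial F) where
  carrier := {f | ∀ i : ℕ, f.coeff i ∈ L ^ i}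
  mul_mem' := by
    intro f g hf hg i
    rw [Polynomial.coeff_mul]
    refine Submodule.sum_mem _ fun x hx => ?_
    rw [← Finset.HasAntidiagonal.mem_antidiagonal.mp hx, pow_add]
    exact Submodule.mul_mem_mul (hf _) (hg _)
  add_mem' := by
    intro f g hf hg i
    rw [Polynomial.coeff_add]
    exact Submodule.add_mem _ (hf i) (hg i)
  algebraMap_mem' := by
    intro c i
    rw [Polynomial.algebraMap_apply, Polynomial.coeff_C]
    split_ifs with h
    · subst h
      rw [pow_zero]
      exact Submodule.algebraMap_mem c
    · exact Submodule.zero_mem _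

/-- Algebras of integral type: graded subalgebras that are finitely generated modules over `A_L`
for some non-zero finite dimensional subspace `L`. -/
def IsIntegralType (A : Subalgebra k (Polynomial F)) : Prop :=
  IsGraded A ∧ ∃ L : Submodule k F, L ≠ ⊥ ∧ FiniteDimensional k L ∧
    ∃ N : Submodule (algebraOf L) (Polynomial F), N.FG ∧ (N : Set (Polynomial F)) = A

/-- Algebras of almost integral type: graded subalgebras contained in an algebra of integral
type. -/
def IsAlmostIntegralType (A : Subalgebra k (Polynomial F)) : Prop :=
  IsGraded A ∧ ∃ B : Subalgebra k (Polynomial F), IsIntegralType B ∧ A ≤ B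

/-- `Â_p`, the subalgebra generated by the homogeneous component `A_p`. -/
def levelAlgebra (A : Subalgebra k (Polynomial F)) (p : ℕ) : Subalgebra k (Polynomial F) :=
  Algebra.adjoin k (component A p : Set (Polynomial F))

end Algebras

/-! ### Valuations -/

section Valuations

variable {F Γ : Type*} [Field F] [AddCommGroup Γ] [LinearOrder Γ] [IsOrderedAddMonoid Γ]

/-- The valuation `v` on the `k`-algebra `F` with values in the ordered group `Γ` (and `v 0 = ⊤`)
is constant on non-zero multiples by scalars of `k`, takes all values in `Γ`, and has
one-dimensional leaves: for each `γ`, the quotient of `{v ≥ γ}` by `{v > γ}` has dimension at most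
one over `k`. -/
structure IsFaithfulOneDimLeaves (k : Type*) [Field k] [Algebra k F]
    (v : AddValuation F (WithTop Γ)) : Prop where
  map_smul : ∀ c : k, c ≠ 0 → ∀ f : F, v (c • f) = v f
  faithful : ∀ γ : Γ, ∃ f : F, v f = (γ : WithTop Γ)
  leaf : ∀ f g : F, g ≠ 0 → v f = v g → ∃ c : k, v g < v (f - c • g)

/-- The value of the extended valuation `v_t` at a non-zero polynomial `P = aᵢ tⁱ + ⋯ + a₀`,
`aᵢ ≠ 0`: it is `(v aᵢ, i)`, where `Γ` is identified with `ℤⁿ` by `e`. -/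
def polyVal (e : Γ ≃+ (Fin n → ℤ)) (v : AddValuation F (WithTop Γ)) (P : Polynomial F) : Lat n :=
  (e ((v P.leadingCoeff).untopD 0), (P.natDegree : ℤ))

/-- The semigroup `S(A) = v_t(A ∖ {0})`. -/
def semigroup {k : Type*} [Field k] [Algebra k F] (e : Γ ≃+ (Fin n → ℤ))
    (v : AddValuation F (WithTop Γ)) (A : Subalgebra k (Polynomial F)) : Set (Lat n) :=
  polyVal e v '' {P | P ∈ A ∧ P ≠ 0}

end Valuations

end NewtonOkounkov

end

open NewtonOkounkov

open NewtonOkounkov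

/-! One-dimensional leaves turn dimensions into counts of values: a subspace of `F` with finitely
many values has dimension equal to their number (`rank_eq_encard_values`), so `H_A(i)` is the number
of points of `S(A)` at level `i`. The rest is convex geometry of the semigroup `S(A)`.

The semigroup lies in a pointed cone (`exists_abs_latVal_pow_le`). Elements whose values form the
standard basis of `ℤⁿ` are a transcendence basis `x` of `F`. Up to a factor `h ^ i`, an element of
`L ^ i` is an eigenvalue of a matrix of fixed size whose entries are polynomials in `x` of degree
linear in `i`; comparing values in its characteristic equation bounds its value linearly in `i`.

Coordinates on `G(S)` turn it into `ℤ^q × ℤ`, with the level divided by `m` (`exists_coordinates`).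
A semigroup that generates the whole lattice contains, at high levels, every lattice point of its
cone that stays away from the boundary (`exists_latPts_subset_levelPts`). Hence level `k` has about
`k ^ q` times the volume of the section of the cone, and returning to integral volume multiplies
that volume by `ind`.

For the approximation, shrink the section by a ratio `r < 1` to a set `K`. Once `j` is large, every
lattice point of `(t * j) K` is, for all `t > 0` simultaneously, a sum of `t` points of the
semigroup at level `j` (`exists_inner_approximation`). All these points are therefore values of
`Â_{mj}`, so that `φ(mj) ≥ r ^ q * j ^ q * V`, where `V` is the volume of the section; the inclusion
of `Â_{mj}` in `A` gives `φ(mj) ≤ j ^ q * V`. Let `r` tend to `1`. High levels also contain a point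
together with its coordinate neighbours; the differences generate `G₀`, so `Â_{mj}` and `A` have the
same `G₀`, hence the same dimension and index. -/

namespace NewtonOkounkov

open scoped Pointwise

/-! ### Lattice values of field elements -/

section LatticeValue

variable {F Γ : Type*} [Field F] [AddCommGroup Γ] [LinearOrder Γ] [IsOrderedAddMonoid Γ] {n : ℕ}

/-- The value of a field element, as a point of `ℤⁿ` (and `0` for the zero element). -/
def latVal (e : Γ ≃+ (Fin n → ℤ)) (v : AddValuation F (WithTop Γ)) (f : F) : Fin n → ℤ :=
  e ((v f).untopD 0)

variable {e : Γ ≃+ (Fin n → ℤ)} {v : AddValuation F (WithTop Γ)}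

theorem val_ne_top {f : F} (hf : f ≠ 0) : v f ≠ ⊤ := fun h => hf ((AddValuation.top_iff v).1 h)

theorem latVal_mul {f g : F} (hf : f ≠ 0) (hg : g ≠ 0) :
    latVal e v (f * g) = latVal e v f + latVal e v g := by
  obtain ⟨a, ha⟩ := WithTop.ne_top_iff_exists.1 (val_ne_top (v := v) hf)
  obtain ⟨b, hb⟩ := WithTop.ne_top_iff_exists.1 (val_ne_top (v := v) hg)
  simp only [latVal, AddValuation.map_mul, ← ha, ← hb, ← WithTop.coe_add, WithTop.untopD_coe,
    map_add]

theorem latVal_one : latVal e v 1 = 0 := by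
  simp [latVal]

theorem latVal_pow {f : F} (hf : f ≠ 0) (i : ℕ) : latVal e v (f ^ i) = i • latVal e v f := by
  induction i with
  | zero => simp [latVal_one]
  | succ i ih => rw [pow_succ, latVal_mul (pow_ne_zero _ hf) hf, ih, succ_nsmul]

theorem latVal_eq_iff {f g : F} (hf : f ≠ 0) (hg : g ≠ 0) :
    latVal e v f = latVal e v g ↔ v f = v g := by
  obtain ⟨a, ha⟩ := WithTop.ne_top_iff_exists.1 (val_ne_top (v := v) hf)
  obtain ⟨b, hb⟩ := WithTop.ne_top_iff_exists.1 (val_ne_top (v := v) hg)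
  simp [latVal, ← ha, ← hb]

/-- A sum of two elements of different values takes the smaller value, so cancellation of leading
terms cannot occur when all values are distinct. -/
theorem exists_val_sum_eq {ι : Type*} (v : AddValuation F (WithTop Γ)) (f : ι → F) (s : Finset ι)
    (hs : s.Nonempty) (hinj : Set.InjOn (fun i => v (f i)) s) :
    ∃ i ∈ s, v (∑ i ∈ s, f i) = v (f i) := by
  classical
  induction hs using Finset.Nonempty.cons_induction with
  | singleton a => exact ⟨a, by simp⟩
  | cons a s ha hs ih =>
    obtain ⟨i, hi, hv⟩ := ih (hinj.mono (by simp))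
    rw [Finset.sum_cons]
    have hne : v (f a) ≠ v (∑ i ∈ s, f i) := by
      rw [hv]
      intro h
      have := hinj (by simp) (by simp [hi]) h
      exact ha (this ▸ hi)
    rw [AddValuation.map_add_of_distinct_val v hne, hv]
    rcases min_choice (v (f a)) (v (f i)) with h | h
    · exact ⟨a, by simp, h⟩
    · exact ⟨i, by simp [hi], h⟩

/-- If a sum of non-zero elements vanishes, then two of the terms have the same value. -/
theorem exists_val_eq_of_sum_eq_zero {ι : Type*} (v : AddValuation F (WithTop Γ)) (f : ι → F)
    (s : Finset ι) (hs : s.Nonempty) (hf : ∀ i ∈ s, f i ≠ 0) (h0 : ∑ i ∈ s, f i = 0) :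
    ∃ i ∈ s, ∃ j ∈ s, i ≠ j ∧ v (f i) = v (f j) := by
  by_contra! H
  obtain ⟨i, hi, hv⟩ := exists_val_sum_eq v f s hs
    (fun i hi j hj hij => by_contra fun hne => H i hi j hj hne hij)
  rw [h0, AddValuation.map_zero] at hv
  exact val_ne_top (hf i hi) hv.symm

end LatticeValue

/-! ### Bounds for the values of algebraic elements -/

section Bounds

variable {k F Γ : Type*} [Field k] [Field F] [Algebra k F]
  [AddCommGroup Γ] [LinearOrder Γ] [IsOrderedAddMonoid Γ] {n : ℕ}
  {e : Γ ≃+ (Fin n → ℤ)} {v : AddValuation F (WithTop Γ)}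

theorem IsFaithfulOneDimLeaves.exists_latVal (hv : IsFaithfulOneDimLeaves k v) (a : Fin n → ℤ) :
    ∃ f : F, f ≠ 0 ∧ latVal e v f = a := by
  obtain ⟨f, hf⟩ := hv.faithful (e.symm a)
  refine ⟨f, ?_, by simp [latVal, hf]⟩
  rintro rfl
  simp at hf

theorem latVal_monomial {x : Fin n → F} (hx0 : ∀ i, x i ≠ 0)
    (hx : ∀ i, latVal e v (x i) = Pi.single i 1) (a : Fin n →₀ ℕ) :
    latVal e v (∏ i, x i ^ a i) = fun i => (a i : ℤ) := by
  have h : ∀ s : Finset (Fin n), latVal e v (∏ i ∈ s, x i ^ a i) =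
      ∑ i ∈ s, (a i : ℤ) • Pi.single i 1 := by
    intro s
    induction s using Finset.cons_induction with
    | empty => simp [latVal_one]
    | cons j s hj ih =>
      rw [Finset.prod_cons, Finset.sum_cons, latVal_mul (pow_ne_zero _ (hx0 j))
        (Finset.prod_ne_zero_iff.2 fun i _ => pow_ne_zero _ (hx0 i)), ih, latVal_pow (hx0 j), hx]
      simp
  rw [h]
  ext j
  simp [Finset.sum_apply, Pi.single_apply]

/-- The value of a polynomial in elements whose values form the standard basis of `ℤⁿ` is one of
its exponents. -/
theorem exists_mem_support_latVal_aeval (hv : IsFaithfulOneDimLeaves k v) {x : Fin n → F}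
    (hx0 : ∀ i, x i ≠ 0) (hx : ∀ i, latVal e v (x i) = Pi.single i 1)
    {P : MvPolynomial (Fin n) k} (hP : P ≠ 0) :
    ∃ a ∈ P.support, MvPolynomial.aeval x P ≠ 0 ∧
      latVal e v (MvPolynomial.aeval x P) = fun i => (a i : ℤ) := by
  have hmon : ∀ a : Fin n →₀ ℕ, ∏ i, x i ^ a i ≠ 0 := fun a =>
    Finset.prod_ne_zero_iff.2 fun i _ => pow_ne_zero _ (hx0 i)
  have hsum : MvPolynomial.aeval x P = ∑ a ∈ P.support, P.coeff a • ∏ i, x i ^ a i := by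
    rw [MvPolynomial.aeval_def, MvPolynomial.eval₂_eq']
    exact Finset.sum_congr rfl fun a _ => (Algebra.smul_def _ _).symm
  have hval : ∀ a ∈ P.support, v (P.coeff a • ∏ i, x i ^ a i) = v (∏ i, x i ^ a i) :=
    fun a ha => hv.map_smul _ (MvPolynomial.mem_support_iff.1 ha) _
  obtain ⟨a, ha, h⟩ := exists_val_sum_eq v (fun a : Fin n →₀ ℕ => P.coeff a • ∏ i, x i ^ a i)
    P.support (by simpa using hP) (by
      intro a ha b hb hab
      simp only [hval a ha, hval b hb] at hab
      rw [← latVal_eq_iff (e := e) (hmon a) (hmon b), latVal_monomial hx0 hx,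
        latVal_monomial hx0 hx] at hab
      ext i
      exact_mod_cast congrFun hab i)
  rw [← hsum, hval a ha] at h
  refine ⟨a, ha, ?_, ?_⟩
  · intro h0
    rw [h0, AddValuation.map_zero] at h
    exact val_ne_top (hmon a) h.symm
  · rw [← latVal_monomial hx0 hx a]
    simp only [latVal, h]

theorem abs_latVal_aeval_le (hv : IsFaithfulOneDimLeaves k v) {x : Fin n → F}
    (hx0 : ∀ i, x i ≠ 0) (hx : ∀ i, latVal e v (x i) = Pi.single i 1)
    {P : MvPolynomial (Fin n) k} (hP : P ≠ 0) (j : Fin n) :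
    |latVal e v (MvPolynomial.aeval x P) j| ≤ P.totalDegree := by
  obtain ⟨a, ha, -, h⟩ := exists_mem_support_latVal_aeval hv hx0 hx hP
  rw [h, Nat.abs_cast, Nat.cast_le]
  refine le_trans ?_ (MvPolynomial.le_totalDegree ha)
  rw [Finsupp.sum_fintype _ _ (fun _ => rfl)]
  exact Finset.single_le_sum (f := fun i => a i) (fun _ _ => Nat.zero_le _) (Finset.mem_univ j)

theorem aeval_ne_zero_of_latVal (hv : IsFaithfulOneDimLeaves k v) {x : Fin n → F}
    (hx0 : ∀ i, x i ≠ 0) (hx : ∀ i, latVal e v (x i) = Pi.single i 1)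
    {P : MvPolynomial (Fin n) k} (hP : P ≠ 0) : MvPolynomial.aeval x P ≠ 0 := by
  obtain ⟨a, -, h, -⟩ := exists_mem_support_latVal_aeval hv hx0 hx hP
  exact h

/-- Distinct monomials in `x` have distinct values, so no non-zero polynomial vanishes at `x`. Being
as many as the transcendence degree, these independent elements form a transcendence basis. -/
theorem isAlgebraic_adjoin_of_latVal (htr : Algebra.trdeg k F = n)
    (hv : IsFaithfulOneDimLeaves k v) {x : Fin n → F}
    (hx0 : ∀ i, x i ≠ 0) (hx : ∀ i, latVal e v (x i) = Pi.single i 1) :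
    Algebra.IsAlgebraic (Algebra.adjoin k (Set.range x)) F := by
  have hind : AlgebraicIndependent k x := by
    rw [algebraicIndependent_iff]
    intro P hP
    by_contra hne
    exact aeval_ne_zero_of_latVal hv hx0 hx hne hP
  exact (hind.isTranscendenceBasis_of_lift_trdeg_le_of_finite (by simp [htr])).isAlgebraic

/-- Degree bound for the coefficients of a characteristic polynomial. -/
theorem totalDegree_coeff_charpoly_le {R σ : Type*} [CommRing R] {D : ℕ} {N : ℕ}
    (P : Matrix (Fin D) (Fin D) (MvPolynomial σ R)) (hP : ∀ a b, (P a b).totalDegree ≤ N) (j : ℕ) :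
    (P.charpoly.coeff j).totalDegree ≤ D * N := by
  -- Each term of the determinant is a product of `D` entries of the characteristic matrix. The
  -- added variable on the diagonal has constant coefficients, so every factor contributes at most
  -- `N` to the degree.
  have hmul : ∀ (s : Finset (Fin D)) (Q : Fin D → Polynomial (MvPolynomial σ R)),
      (∀ a i, ((Q a).coeff i).totalDegree ≤ N) →
      ∀ i, ((∏ a ∈ s, Q a).coeff i).totalDegree ≤ s.card * N := by
    intro s Q hQ
    induction s using Finset.cons_induction with
    | empty =>
      intro i
      rw [Finset.prod_empty, Polynomial.coeff_one]
      split_ifs <;> simp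
    | cons a s ha ih =>
      intro i
      rw [Finset.prod_cons, Polynomial.coeff_mul, Finset.card_cons]
      refine MvPolynomial.totalDegree_finsetSum_le fun u _ => ?_
      refine (MvPolynomial.totalDegree_mul _ _).trans ?_
      have := hQ a u.1
      have := ih u.2
      rw [Nat.succ_mul]
      lia
  have hentry : ∀ a b i, ((P.charmatrix a b).coeff i).totalDegree ≤ N := by
    intro a b i
    rw [Matrix.charmatrix_apply, Polynomial.coeff_sub, Polynomial.coeff_C]
    refine (MvPolynomial.totalDegree_sub _ _).trans (max_le ?_ ?_)
    · rw [Matrix.diagonal_apply]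
      split_ifs
      · rw [Polynomial.coeff_X]; split_ifs <;> simp
      · simp
    · split_ifs
      · exact hP a b
      · simp
  rw [Matrix.charpoly, Matrix.det_apply, Polynomial.finsetSum_coeff]
  refine MvPolynomial.totalDegree_finsetSum_le fun u _ => ?_
  have := hmul Finset.univ (fun i => P.charmatrix (u i) i) (fun a i => hentry _ _ i) j
  rw [Finset.card_univ, Fintype.card_fin] at this
  rcases Int.units_eq_one_or (Equiv.Perm.sign u) with h | h
  · simpa [h] using this
  · simpa [h] using this

/-- The value of an element satisfying a polynomial eigenvector equation is bounded in terms of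
the degrees of the entries. -/
theorem abs_latVal_le_of_mulVec (hv : IsFaithfulOneDimLeaves k v) {x : Fin n → F}
    (hx0 : ∀ i, x i ≠ 0) (hx : ∀ i, latVal e v (x i) = Pi.single i 1) {D N : ℕ}
    {P : Matrix (Fin D) (Fin D) (MvPolynomial (Fin n) k)}
    (hP : ∀ a b, (P a b).totalDegree ≤ N) {u : Fin D → F} (hu : u ≠ 0) {g : F} (hg : g ≠ 0)
    (h : (P.map (MvPolynomial.aeval x)).mulVec u = g • u) (a : Fin n) :
    |latVal e v g a| ≤ 2 * D * N := by
  have hdet : (Matrix.scalar (Fin D) g - P.map (MvPolynomial.aeval x)).det = 0 := by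
    rw [← Matrix.exists_mulVec_eq_zero_iff]
    refine ⟨u, hu, ?_⟩
    rw [Matrix.sub_mulVec, h, sub_eq_zero]
    ext i
    simp [Matrix.scalar_apply, Matrix.mulVec_diagonal]
  -- The characteristic equation is a vanishing sum of the terms `c_j(x) * g ^ j`, so two of the
  -- non-zero terms share a value. This expresses `(i - j) • v(g)` as a difference of values of two
  -- coefficients, each bounded by `D * N`, with `|i - j| ≥ 1`.
  set c : Polynomial (MvPolynomial (Fin n) k) := P.charpoly with hc
  have hroot : ∑ j ∈ c.support, MvPolynomial.aeval x (c.coeff j) * g ^ j = 0 := by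
    rw [← Matrix.eval_charpoly, show P.map (MvPolynomial.aeval x) =
      P.map (MvPolynomial.aeval x : MvPolynomial (Fin n) k →ₐ[k] F).toRingHom from rfl,
      Matrix.charpoly_map, Polynomial.eval_map, Polynomial.eval₂_eq_sum, Polynomial.sum_def] at hdet
    exact hdet
  have hne : c.support.Nonempty := by
    rw [Polynomial.support_nonempty]
    exact (Matrix.charpoly_monic P).ne_zero
  have haev : ∀ j ∈ c.support, MvPolynomial.aeval x (c.coeff j) ≠ 0 := fun j hj =>
    aeval_ne_zero_of_latVal hv hx0 hx (Polynomial.mem_support_iff.1 hj)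
  obtain ⟨i, hi, j, hj, hij, hval⟩ := exists_val_eq_of_sum_eq_zero v
    (fun j => MvPolynomial.aeval x (c.coeff j) * g ^ j) c.support hne
    (fun j hj => mul_ne_zero (haev j hj) (pow_ne_zero _ hg)) hroot
  rw [← latVal_eq_iff (e := e) (mul_ne_zero (haev i hi) (pow_ne_zero _ hg))
    (mul_ne_zero (haev j hj) (pow_ne_zero _ hg)), latVal_mul (haev i hi) (pow_ne_zero _ hg),
    latVal_mul (haev j hj) (pow_ne_zero _ hg), latVal_pow hg, latVal_pow hg] at hval
  have hval' := congrFun hval a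
  rw [Pi.add_apply, Pi.add_apply, Pi.smul_apply, Pi.smul_apply, nsmul_eq_mul, nsmul_eq_mul] at hval'
  have hi' := abs_latVal_aeval_le (e := e) hv hx0 hx (Polynomial.mem_support_iff.1 hi) a
  have hj' := abs_latVal_aeval_le (e := e) hv hx0 hx (Polynomial.mem_support_iff.1 hj) a
  have hi'' : ((c.coeff i).totalDegree : ℤ) ≤ D * N :=
    mod_cast totalDegree_coeff_charpoly_le P hP i
  have hj'' : ((c.coeff j).totalDegree : ℤ) ≤ D * N :=
    mod_cast totalDegree_coeff_charpoly_le P hP j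
  have hsub : ((i : ℤ) - j) * latVal e v g a =
      latVal e v (MvPolynomial.aeval x (c.coeff j)) a
        - latVal e v (MvPolynomial.aeval x (c.coeff i)) a := by linarith
  have hone : 1 ≤ |(i : ℤ) - j| := Int.one_le_abs (by
    intro h0; apply hij; exact_mod_cast sub_eq_zero.1 h0)
  calc |latVal e v g a| ≤ |(i : ℤ) - j| * |latVal e v g a| :=
        le_mul_of_one_le_left (abs_nonneg _) hone
    _ = |latVal e v (MvPolynomial.aeval x (c.coeff j)) a
        - latVal e v (MvPolynomial.aeval x (c.coeff i)) a| := by rw [← abs_mul, hsub]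
    _ ≤ _ := abs_sub _ _
    _ ≤ 2 * D * N := by linarith

end Bounds

/-! ### Linear growth of values on the powers of a finite dimensional subspace -/

section PowerBounds

variable {k F Γ : Type*} [Field k] [Field F] [Algebra k F]
  [AddCommGroup Γ] [LinearOrder Γ] [IsOrderedAddMonoid Γ] {n : ℕ}
  {e : Γ ≃+ (Fin n → ℤ)} {v : AddValuation F (WithTop Γ)}

/-- The elements `f` for which `u` is an eigenvector, with eigenvalue `h * f`, of a matrix whose
entries are polynomials of degree at most `s` in `x`. -/
def eigenSubmodule (x : Fin n → F) {D : ℕ} (u : Fin D → F) (h : F) (s : ℕ) : Submodule k F where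
  carrier := {f | ∃ P : Matrix (Fin D) (Fin D) (MvPolynomial (Fin n) k),
    (∀ a b, (P a b).totalDegree ≤ s) ∧ (P.map (MvPolynomial.aeval x)).mulVec u = (h * f) • u}
  zero_mem' := ⟨0, by simp, by ext; simp [Matrix.mulVec, dotProduct]⟩
  add_mem' := by
    rintro f g ⟨P, hP, hPu⟩ ⟨Q, hQ, hQu⟩
    refine ⟨P + Q, fun a b => (MvPolynomial.totalDegree_add _ _).trans (max_le (hP a b) (hQ a b)),
      ?_⟩
    rw [Matrix.map_add _ (map_add _), Matrix.add_mulVec, hPu, hQu, mul_add, add_smul]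
  smul_mem' := by
    rintro c f ⟨P, hP, hPu⟩
    refine ⟨c • P, fun a b => (MvPolynomial.totalDegree_smul_le _ _).trans (hP a b), ?_⟩
    rw [Matrix.map_smul _ _ (fun a => map_smul _ _ _), Matrix.smul_mulVec, hPu, ← smul_assoc,
      mul_smul_comm]

theorem mem_eigenSubmodule {x : Fin n → F} {D : ℕ} {u : Fin D → F} {h : F} {s : ℕ} {f : F} :
    f ∈ (eigenSubmodule x u h s : Submodule k F) ↔
      ∃ P : Matrix (Fin D) (Fin D) (MvPolynomial (Fin n) k),
        (∀ a b, (P a b).totalDegree ≤ s) ∧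
          (P.map (MvPolynomial.aeval x)).mulVec u = (h * f) • u := Iff.rfl

/-- Matrices sharing the eigenvector `u` multiply as their eigenvalues do, while the degrees of
their entries add. The size `D` does not grow with `i`, which is what makes the final bound linear.
-/
theorem pow_le_eigenSubmodule {x : Fin n → F} {D : ℕ} {u : Fin D → F} {h : F} {s : ℕ}
    {L : Submodule k F} (hL : L ≤ eigenSubmodule x u h s) (i : ℕ) :
    L ^ i ≤ eigenSubmodule x u (h ^ i) (i * s) := by
  induction i with
  | zero =>
    rw [pow_zero, Submodule.one_le]
    refine mem_eigenSubmodule.2 ⟨1, fun a b => ?_, ?_⟩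
    · rw [Matrix.one_apply]; split_ifs <;> simp
    · rw [Matrix.map_one _ (map_zero _) (map_one _), Matrix.one_mulVec]; simp
  | succ i ih =>
    rw [pow_succ, Submodule.mul_le]
    intro f hf g hg
    obtain ⟨P, hP, hPu⟩ := ih hf
    obtain ⟨Q, hQ, hQu⟩ := hL hg
    refine mem_eigenSubmodule.2 ⟨P * Q, fun a b => ?_, ?_⟩
    · rw [Matrix.mul_apply]
      refine MvPolynomial.totalDegree_finsetSum_le fun c _ => ?_
      refine (MvPolynomial.totalDegree_mul _ _).trans ?_
      rw [Nat.succ_mul]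
      exact add_le_add (hP a c) (hQ c b)
    · rw [Matrix.map_mul, ← Matrix.mulVec_mulVec, hQu, Matrix.mulVec_smul, hPu, smul_smul]
      congr 1
      ring

/-- A finite dimensional subspace of an algebraic extension acts, up to a common denominator, by
polynomial matrices on a common vector. -/
theorem exists_le_eigenSubmodule {x : Fin n → F}
    (halg : Algebra.IsAlgebraic (Algebra.adjoin k (Set.range x)) F)
    (L : Submodule k F) [FiniteDimensional k L] :
    ∃ (D : ℕ) (u : Fin D → F) (h : F) (s : ℕ), u ≠ 0 ∧ h ≠ 0 ∧ L ≤ eigenSubmodule x u h s := by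
  classical
  set R := Algebra.adjoin k (Set.range x) with hR
  obtain ⟨T, hT⟩ : ∃ T : Finset F, Submodule.span k (T : Set F) = L :=
    (Submodule.fg_iff_finiteDimensional L).2 inferInstance
  -- Once multiplied by `h`, the generators of `L` are integral over `R`, so the algebra `M` they
  -- generate is a finite `R`-module. Multiplication by `h * z` on a generating family `u` of `M` is
  -- given by a matrix over `R`, whose entries lift to polynomials.
  obtain ⟨h, hh0, hint⟩ := Algebra.IsAlgebraic.exists_integral_multiples R T
  set M : Subalgebra R F := Algebra.adjoin R ((fun z => h • z) '' (T : Set F)) with hM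
  have hfg : (Subalgebra.toSubmodule M).FG := fg_adjoin_of_finite (T.finite_toSet.image _) (by
    rintro _ ⟨z, hz, rfl⟩
    exact hint z hz)
  obtain ⟨D, u, hu⟩ := Submodule.fg_iff_exists_fin_generating_family.1 hfg
  have hu0 : u ≠ 0 := by
    rintro rfl
    have : (1 : F) ∈ Submodule.span R (Set.range (0 : Fin D → F)) := by
      rw [hu]; exact one_mem M
    rw [Submodule.span_eq_bot.2 (by rintro _ ⟨a, rfl⟩; rfl), Submodule.mem_bot] at this
    exact one_ne_zero this
  have hcoef : ∀ z ∈ T, ∀ a : Fin D, ∃ c : Fin D → MvPolynomial (Fin n) k,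
      ∑ b, MvPolynomial.aeval x (c b) * u b = ((h : F) * z) * u a := by
    intro z hz a
    have h1 : ((h : F) * z) * u a ∈ Submodule.span R (Set.range u) := by
      rw [hu]
      refine mul_mem (S := Subalgebra R F) (Algebra.subset_adjoin ⟨z, hz, rfl⟩) ?_
      have : u a ∈ Submodule.span R (Set.range u) := Submodule.subset_span ⟨a, rfl⟩
      rwa [hu] at this
    obtain ⟨c, hc⟩ := (Submodule.mem_span_range_iff_exists_fun R).1 h1
    have hrep : ∀ r : R, ∃ p : MvPolynomial (Fin n) k, MvPolynomial.aeval x p = (r : F) := by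
      intro r
      have h2 : (r : F) ∈ (MvPolynomial.aeval x : MvPolynomial (Fin n) k →ₐ[k] F).range :=
        (Algebra.adjoin_range_eq_range_aeval k x) ▸ r.2
      exact h2
    choose p hp using hrep
    refine ⟨fun b => p (c b), ?_⟩
    rw [← hc]
    refine Finset.sum_congr rfl fun b _ => ?_
    rw [hp]
    rfl
  choose! c hc using hcoef
  refine ⟨D, u, h, T.sup fun z => Finset.univ.sup fun a => Finset.univ.sup fun b =>
    (c z a b).totalDegree, hu0, fun h0 => hh0 (Subtype.ext h0), ?_⟩
  rw [← hT, Submodule.span_le]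
  intro z hz
  refine mem_eigenSubmodule.2 ⟨Matrix.of (c z), fun a b => ?_, ?_⟩
  · refine le_trans ?_ (Finset.le_sup (f := fun z => Finset.univ.sup fun a =>
      Finset.univ.sup fun b => (c z a b).totalDegree) hz)
    refine le_trans ?_ (Finset.le_sup (f := fun a =>
      Finset.univ.sup fun b => (c z a b).totalDegree) (Finset.mem_univ a))
    exact Finset.le_sup (f := fun b => (c z a b).totalDegree) (Finset.mem_univ b)
  · ext a
    simp only [Matrix.mulVec, dotProduct, Matrix.map_apply, Matrix.of_apply, Pi.smul_apply,
      smul_eq_mul]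
    exact hc z hz a

/-- The values of the elements of `Lⁱ` grow at most linearly in `i`. -/
theorem exists_abs_latVal_pow_le (e : Γ ≃+ (Fin n → ℤ)) (htr : Algebra.trdeg k F = n)
    (hv : IsFaithfulOneDimLeaves k v) (L : Submodule k F) [FiniteDimensional k L] :
    ∃ C : ℕ, ∀ i : ℕ, ∀ f ∈ L ^ i, f ≠ 0 → ∀ j, |latVal e v f j| ≤ C * i := by
  choose x hx0 hx using fun i : Fin n => hv.exists_latVal (e := e) (Pi.single i 1)
  obtain ⟨D, u, h, s, hu, hh, hL⟩ :=
    exists_le_eigenSubmodule (isAlgebraic_adjoin_of_latVal htr hv hx0 hx) L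
  -- The matrix bound controls the value of `h ^ i * f` by `2 * D * (i * s)`; removing `h ^ i` costs
  -- at most `i` times the value of `h`, and the sum bounds all coordinates of that value at once.
  refine ⟨2 * D * s + ∑ j, (latVal e v h j).natAbs, fun i f hf hf0 j => ?_⟩
  obtain ⟨P, hP, hPu⟩ := pow_le_eigenSubmodule hL i hf
  have hb := abs_latVal_le_of_mulVec hv hx0 hx hP hu (mul_ne_zero (pow_ne_zero i hh) hf0) hPu j
  rw [latVal_mul (pow_ne_zero i hh) hf0, latVal_pow hh, Pi.add_apply, Pi.smul_apply,
    nsmul_eq_mul] at hb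
  have hj : |latVal e v h j| ≤ ((∑ j, (latVal e v h j).natAbs : ℕ) : ℤ) := by
    rw [Int.abs_eq_natAbs, Nat.cast_le]
    exact Finset.single_le_sum (f := fun j => (latVal e v h j).natAbs)
      (fun _ _ => Nat.zero_le _) (Finset.mem_univ j)
  have htri : |latVal e v f j| ≤ |(i : ℤ) * latVal e v h j + latVal e v f j| +
      |(i : ℤ) * latVal e v h j| := by
    have := abs_sub ((i : ℤ) * latVal e v h j + latVal e v f j) ((i : ℤ) * latVal e v h j)
    rwa [add_sub_cancel_left] at this
  rw [abs_mul (i : ℤ), Nat.abs_cast] at htri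
  have h3 := mul_le_mul_of_nonneg_left hj (Nat.cast_nonneg (α := ℤ) i)
  push_cast at hb h3 ⊢
  calc |latVal e v f j| ≤ _ := htri
    _ ≤ 2 * D * (i * s) + i * ∑ x, |latVal e v h x| := add_le_add hb h3
    _ = _ := by ring

end PowerBounds

/-! ### Homogeneous components -/

section Components

variable {k F Γ : Type*} [Field k] [Field F] [Algebra k F]
  [AddCommGroup Γ] [LinearOrder Γ] [IsOrderedAddMonoid Γ] {n : ℕ}
  {e : Γ ≃+ (Fin n → ℤ)} {v : AddValuation F (WithTop Γ)}

/-- The coefficients of the homogeneous elements of degree `i` of `A`. -/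
noncomputable def coeffSpace (A : Subalgebra k (Polynomial F)) (i : ℕ) : Submodule k F :=
  (Subalgebra.toSubmodule A).comap
    ((Polynomial.monomial i : F →ₗ[F] Polynomial F).restrictScalars k)

theorem mem_coeffSpace {A : Subalgebra k (Polynomial F)} {i : ℕ} {f : F} :
    f ∈ coeffSpace A i ↔ Polynomial.monomial i f ∈ A := Iff.rfl

theorem component_eq_map (A : Subalgebra k (Polynomial F)) (i : ℕ) :
    component A i = (coeffSpace A i).map
      ((Polynomial.monomial i : F →ₗ[F] Polynomial F).restrictScalars k) := by
  rw [component, coeffSpace, Submodule.map_comap_eq, inf_comm]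

theorem monomial_injective (i : ℕ) : Function.Injective
    ((Polynomial.monomial i : F →ₗ[F] Polynomial F).restrictScalars k) :=
  Polynomial.monomial_injective i

theorem component_eq_bot_iff {A : Subalgebra k (Polynomial F)} {i : ℕ} :
    component A i = ⊥ ↔ coeffSpace A i = ⊥ := by
  rw [component_eq_map]
  exact ⟨fun h => Submodule.map_injective_of_injective (monomial_injective i)
    (h.trans (Submodule.map_bot _).symm), fun h => by rw [h, Submodule.map_bot]⟩

theorem hilbert_eq_rank (A : Subalgebra k (Polynomial F)) (i : ℕ) :
    hilbert A i = Cardinal.toENat (Module.rank k (coeffSpace A i)) := by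
  rw [hilbert, component_eq_map]
  congr 1
  exact (Submodule.equivMapOfInjective _ (monomial_injective i) _).rank_eq.symm

theorem hilbert_mono {A B : Subalgebra k (Polynomial F)} (h : A ≤ B) (i : ℕ) :
    hilbert A i ≤ hilbert B i := by
  rw [hilbert_eq_rank, hilbert_eq_rank]
  exact Cardinal.toENat.monotone'
    (Submodule.rank_mono fun f hf => mem_coeffSpace.2 (h (mem_coeffSpace.1 hf)))

theorem mem_semigroup_iff {A : Subalgebra k (Polynomial F)} (hA : IsGraded A) {z : Lat n} :
    z ∈ semigroup e v A ↔ ∃ (i : ℕ) (f : F), f ∈ coeffSpace A i ∧ f ≠ 0 ∧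
      z = (latVal e v f, (i : ℤ)) := by
  constructor
  · rintro ⟨P, ⟨hP, hP0⟩, rfl⟩
    exact ⟨P.natDegree, P.leadingCoeff, hA P hP _, Polynomial.leadingCoeff_ne_zero.2 hP0, rfl⟩
  · rintro ⟨i, f, hf, hf0, rfl⟩
    refine ⟨Polynomial.monomial i f, ⟨hf, by simpa using hf0⟩, ?_⟩
    simp [polyVal, latVal, Polynomial.natDegree_monomial_eq i hf0]

theorem mk_mem_semigroup_iff {A : Subalgebra k (Polynomial F)} (hA : IsGraded A) {i : ℕ}
    {a : Fin n → ℤ} :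
    (a, (i : ℤ)) ∈ semigroup e v A ↔ ∃ f ∈ coeffSpace A i, f ≠ 0 ∧ latVal e v f = a := by
  rw [mem_semigroup_iff hA]
  constructor
  · rintro ⟨j, f, hf, hf0, h⟩
    obtain ⟨h1, h2⟩ := Prod.mk.inj h
    obtain rfl : i = j := by exact_mod_cast h2
    exact ⟨f, hf, hf0, h1.symm⟩
  · rintro ⟨f, hf, hf0, rfl⟩
    exact ⟨i, f, hf, hf0, rfl⟩

/-- The semigroup of a graded algebra, as a submonoid. -/
def valueMonoid (e : Γ ≃+ (Fin n → ℤ)) (v : AddValuation F (WithTop Γ))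
    (A : Subalgebra k (Polynomial F)) (hA : IsGraded A) : AddSubmonoid (Lat n) where
  carrier := semigroup e v A
  zero_mem' := (mem_semigroup_iff hA).2
    ⟨0, 1, mem_coeffSpace.2 (by simp), one_ne_zero, by rw [latVal_one]; rfl⟩
  add_mem' := by
    intro y z hy hz
    obtain ⟨i, f, hf, hf0, rfl⟩ := (mem_semigroup_iff hA).1 hy
    obtain ⟨j, g, hg, hg0, rfl⟩ := (mem_semigroup_iff hA).1 hz
    refine (mem_semigroup_iff hA).2 ⟨i + j, f * g, ?_, mul_ne_zero hf0 hg0, ?_⟩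
    · rw [mem_coeffSpace, ← Polynomial.monomial_mul_monomial]
      exact mul_mem (mem_coeffSpace.1 hf) (mem_coeffSpace.1 hg)
    · rw [latVal_mul hf0 hg0]; simp

@[simp] theorem coe_valueMonoid {A : Subalgebra k (Polynomial F)} (hA : IsGraded A) :
    (valueMonoid e v A hA : Set (Lat n)) = semigroup e v A := rfl

/-- The dimension of a subspace is the number of the values of its non-zero elements. -/
theorem rank_eq_encard_values (hv : IsFaithfulOneDimLeaves k v) (W : Submodule k F)
    (hfin : {a | ∃ f ∈ W, f ≠ 0 ∧ latVal e v f = a}.Finite) :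
    Cardinal.toENat (Module.rank k W) = {a | ∃ f ∈ W, f ≠ 0 ∧ latVal e v f = a}.encard := by
  classical
  set V := {a | ∃ f ∈ W, f ≠ 0 ∧ latVal e v f = a} with hV
  have : Fintype V := hfin.fintype
  choose g hgW hg0 hgv using fun a : V => a.2
  have hli : LinearIndependent k fun a : V => (⟨g a, hgW a⟩ : W) := by
    refine LinearIndependent.of_comp W.subtype ?_
    rw [Fintype.linearIndependent_iff]
    intro c hc
    by_contra! hne
    set s := Finset.univ.filter fun a : V => c a ≠ 0 with hs
    have hsne : s.Nonempty := by
      obtain ⟨a, ha⟩ := hne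
      exact ⟨a, by simpa [hs] using ha⟩
    have hsum : ∑ a ∈ s, c a • g a = 0 := by
      rw [hs, Finset.sum_filter_of_ne]
      · exact hc
      · intro a _ h h0
        simp [h0] at h
    obtain ⟨a, ha, b, hb, hab, hval⟩ := exists_val_eq_of_sum_eq_zero v (fun a => c a • g a) s hsne
      (fun a ha => smul_ne_zero (by simpa [hs] using ha) (hg0 a)) hsum
    rw [hv.map_smul _ (by simpa [hs] using ha), hv.map_smul _ (by simpa [hs] using hb),
      ← latVal_eq_iff (e := e) (hg0 a) (hg0 b), hgv, hgv] at hval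
    exact hab (Subtype.ext hval)
  -- Induction on the number of values of `W` that are at least `v f`: subtracting a scalar multiple
  -- of the chosen element with the value of `f` strictly raises the value. The count is never zero
  -- for `f ≠ 0`, since the value of `f` itself is counted.
  have hspan : ∀ (N : ℕ) (f : F), f ∈ W →
      (Finset.univ.filter fun a : V => v f ≤ v (g a)).card ≤ N →
      f ∈ Submodule.span k (Set.range g) := by
    intro N
    induction N with
    | zero =>
      intro f hf hcard
      by_contra hne
      have hf0 : f ≠ 0 := by rintro rfl; exact hne (zero_mem _)
      have hmem : latVal e v f ∈ V := ⟨f, hf, hf0, rfl⟩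
      rw [Nat.le_zero, Finset.card_eq_zero, Finset.filter_eq_empty_iff] at hcard
      refine hcard (Finset.mem_univ ⟨_, hmem⟩) (le_of_eq ?_)
      rw [← latVal_eq_iff (e := e) hf0 (hg0 _), hgv]
    | succ N ih =>
      intro f hf hcard
      by_cases hf0 : f = 0
      · rw [hf0]; exact zero_mem _
      have hmem : latVal e v f ∈ V := ⟨f, hf, hf0, rfl⟩
      have hvf : v f = v (g ⟨_, hmem⟩) := by
        rw [← latVal_eq_iff (e := e) hf0 (hg0 _), hgv]
      obtain ⟨c, hc⟩ := hv.leaf f (g ⟨_, hmem⟩) (hg0 _) hvf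
      have h1 : f - c • g ⟨_, hmem⟩ ∈ Submodule.span k (Set.range g) := by
        refine ih _ (W.sub_mem hf (W.smul_mem _ (hgW _))) ?_
        refine Nat.lt_succ_iff.1 (lt_of_lt_of_le (Finset.card_lt_card ?_) hcard)
        refine (Finset.ssubset_iff_of_subset ?_).2 ⟨⟨_, hmem⟩, ?_, ?_⟩
        · intro a ha
          simp only [Finset.mem_filter, Finset.mem_univ, true_and] at ha ⊢
          rw [hvf]
          exact hc.le.trans ha
        · simp [hvf]
        · simpa using hc
      have := Submodule.add_mem _ h1
        (Submodule.smul_mem _ c (Submodule.subset_span (Set.mem_range_self (⟨_, hmem⟩ : V))))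
      simpa using this
  have hspan' : ⊤ ≤ Submodule.span k (Set.range fun a : V => (⟨g a, hgW a⟩ : W)) := by
    rintro ⟨f, hf⟩ -
    have := hspan _ f hf le_rfl
    rw [show g = W.subtype ∘ fun a : V => (⟨g a, hgW a⟩ : W) from rfl, Set.range_comp,
      ← Submodule.map_span] at this
    obtain ⟨y, hy, hyf⟩ := this
    rwa [show y = ⟨f, hf⟩ from Subtype.ext hyf] at hy
  rw [rank_eq_card_basis (Module.Basis.mk hli hspan')]
  rw [Set.encard_eq_coe_toFinset_card, Set.toFinset_card]
  simp

theorem hilbert_eq_encard (hv : IsFaithfulOneDimLeaves k v) {A : Subalgebra k (Polynomial F)}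
    (hA : IsGraded A) {i : ℕ} (hfin : {a : Fin n → ℤ | (a, (i : ℤ)) ∈ semigroup e v A}.Finite) :
    hilbert A i = {a : Fin n → ℤ | (a, (i : ℤ)) ∈ semigroup e v A}.encard := by
  simp only [mk_mem_semigroup_iff hA] at hfin ⊢
  rw [hilbert_eq_rank]
  exact rank_eq_encard_values hv _ hfin

/-- The coefficients of the elements of an algebra of integral type lie in powers of a finite
dimensional subspace. -/
theorem IsIntegralType.exists_coeff_mem_pow {B : Subalgebra k (Polynomial F)}
    (hB : IsIntegralType B) :
    ∃ L : Submodule k F, FiniteDimensional k L ∧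
      ∀ f ∈ B, ∀ i, Polynomial.coeff f i ∈ L ^ (i + 1) := by
  classical
  obtain ⟨-, L, -, hL, N, hN, hNB⟩ := hB
  obtain ⟨T, hT⟩ := hN
  -- Enlarge `L` by the scalars and by all coefficients of the module generators. Containing `1`
  -- makes the powers increase, and the one extra factor `L'` in `L' ^ (i + 1)` absorbs the
  -- coefficient of a generator.
  let W : Submodule k F := Submodule.span k
    (T.biUnion fun g => g.support.image g.coeff : Finset F)
  let L' : Submodule k F := L ⊔ 1 ⊔ W
  have h1 : (1 : Submodule k F) ≤ L' := le_sup_right.trans le_sup_left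
  have hfd : FiniteDimensional k L' := by
    have : FiniteDimensional k (1 : Submodule k F) := by
      rw [Submodule.one_eq_span]; infer_instance
    have : FiniteDimensional k W := FiniteDimensional.span_finset k _
    infer_instance
  refine ⟨L', hfd, fun f hf i => ?_⟩
  have hf' : f ∈ Submodule.span (algebraOf L) (T : Set (Polynomial F)) := by
    rw [hT]
    rw [← SetLike.mem_coe, hNB]
    exact hf
  clear hf
  have hg : ∀ g ∈ T, ∀ j, g.coeff j ∈ L' := by
    intro g hg j
    by_cases h0 : g.coeff j = 0
    · rw [h0]; exact zero_mem _
    refine (le_sup_right : W ≤ L') (Submodule.subset_span ?_)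
    rw [Finset.mem_coe, Finset.mem_biUnion]
    exact ⟨g, hg, Finset.mem_image.2 ⟨j, Polynomial.mem_support_iff.2 h0, rfl⟩⟩
  obtain ⟨c, hc⟩ := Submodule.mem_span_finset'.1 hf'
  rw [← hc, Polynomial.finsetSum_coeff]
  refine Submodule.sum_mem _ fun g _ => ?_
  rw [show c g • (g : Polynomial F) = (c g : Polynomial F) * g from rfl, Polynomial.coeff_mul]
  refine Submodule.sum_mem _ fun x hx => ?_
  rw [pow_succ]
  refine Submodule.mul_mem_mul ?_ (hg g g.2 _)
  have h2 : L ^ x.1 ≤ L' ^ i :=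
    (pow_le_pow_left' (le_sup_left.trans le_sup_left) _).trans
      (pow_le_pow_right₀ h1 (by have := Finset.HasAntidiagonal.mem_antidiagonal.1 hx; lia))
  exact h2 ((c g).2 x.1)

end Components

/-! ### Semigroups generating the whole lattice -/

section FullSemigroup

variable {q : ℕ}

/-- The section of the cone of `S` at level one. -/
def section₁ (S : Set (Lat q)) : Set (Fin q → ℝ) := {y | (y, 1) ∈ cone S}

/-- The lattice points of the dilation by `k` of a set. -/
def latPts (K : Set (Fin q → ℝ)) (k : ℕ) : Set (Fin q → ℤ) :=
  {z | ∃ y ∈ K, ∀ i, (z i : ℝ) = k * y i}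

/-- The points of level `k` of a set. -/
def levelPts (S : Set (Lat q)) (k : ℕ) : Set (Fin q → ℤ) := {z | (z, (k : ℤ)) ∈ S}

theorem convex_span_nnreal {E : Type*} [AddCommGroup E] [Module ℝ E] (s : Set E) :
    Convex ℝ (Submodule.span ℝ≥0 s : Set E) := by
  intro x hx y hy a b ha hb _
  exact Submodule.add_mem _ (Submodule.smul_mem _ (⟨a, ha⟩ : ℝ≥0) hx)
    (Submodule.smul_mem _ (⟨b, hb⟩ : ℝ≥0) hy)

theorem convex_cone (S : Set (Lat q)) : Convex ℝ (cone S) := (convex_span_nnreal _).closure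

theorem convex_section₁ (S : Set (Lat q)) : Convex ℝ (section₁ S) := by
  intro x hx y hy a b ha hb hab
  have := convex_cone S hx hy ha hb hab
  simpa [section₁, hab] using this

theorem isClosed_section₁ (S : Set (Lat q)) : IsClosed (section₁ S) :=
  isClosed_closure.preimage (by fun_prop : Continuous fun y : Fin q → ℝ => ((y, 1) : Space q))

/-- The dilation invariant bound expressing that `S` lies in a strictly convex cone. -/
def LinearlyBounded (S : Set (Lat q)) (C : ℕ) : Prop :=
  ∀ s ∈ S, 0 ≤ s.2 ∧ ∀ i, |s.1 i| ≤ C * s.2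

theorem LinearlyBounded.cone_le {S : Set (Lat q)} {C : ℕ} (h : LinearlyBounded S C) {x : Space q}
    (hx : x ∈ cone S) : 0 ≤ x.2 ∧ ∀ i, |x.1 i| ≤ C * x.2 := by
  have hcl : IsClosed {x : Space q | 0 ≤ x.2 ∧ ∀ i, |x.1 i| ≤ C * x.2} := by
    rw [show {x : Space q | 0 ≤ x.2 ∧ ∀ i, |x.1 i| ≤ C * x.2} =
      {x : Space q | 0 ≤ x.2} ∩ ⋂ i, {x : Space q | |x.1 i| ≤ C * x.2} by ext; simp]
    exact (isClosed_le continuous_const continuous_snd).inter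
      (isClosed_iInter fun i => isClosed_le (by fun_prop) (by fun_prop))
  refine closure_minimal ?_ hcl hx
  intro y hy
  induction hy using Submodule.span_induction with
  | mem y hy =>
    obtain ⟨s, hs, rfl⟩ := hy
    obtain ⟨h1, h2⟩ := h s hs
    refine ⟨by simpa [latIncl] using h1, fun i => ?_⟩
    have := h2 i
    simp only [latIncl, AddMonoidHom.coe_mk, ZeroHom.coe_mk]
    exact_mod_cast this
  | zero => simp
  | add y z _ _ hy hz =>
    refine ⟨add_nonneg hy.1 hz.1, fun i => ?_⟩
    calc |y.1 i + z.1 i| ≤ |y.1 i| + |z.1 i| := abs_add_le _ _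
      _ ≤ C * y.2 + C * z.2 := add_le_add (hy.2 i) (hz.2 i)
      _ = C * (y.2 + z.2) := by ring
  | smul c y _ hy =>
    refine ⟨mul_nonneg c.2 hy.1, fun i => ?_⟩
    change |(c : ℝ) * y.1 i| ≤ C * ((c : ℝ) * y.2)
    rw [abs_mul, abs_of_nonneg c.coe_nonneg]
    calc (c : ℝ) * |y.1 i| ≤ c * (C * y.2) := mul_le_mul_of_nonneg_left (hy.2 i) c.2
      _ = _ := by ring

theorem LinearlyBounded.isCompact_section₁ {S : Set (Lat q)} {C : ℕ} (h : LinearlyBounded S C) :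
    IsCompact (section₁ S) := by
  refine (isCompact_closedBall (0 : Fin q → ℝ) C).of_isClosed_subset (isClosed_section₁ S) ?_
  intro y hy
  rw [mem_closedBall_zero_iff, pi_norm_le_iff_of_nonneg (Nat.cast_nonneg _)]
  intro i
  simpa using (h.cone_le hy).2 i

theorem span_latIncl_eq_top {S : Set (Lat q)} (hG : group S = ⊤) :
    Submodule.span ℝ (latIncl q '' S) = ⊤ := by
  have hall : ∀ z : Lat q, latIncl q z ∈ Submodule.span ℝ (latIncl q '' S) := by
    intro z
    have hz : z ∈ group S := hG ▸ AddSubgroup.mem_top z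
    have : group S ≤ (Submodule.span ℝ (latIncl q '' S)).toAddSubgroup.comap (latIncl q) :=
      (AddSubgroup.closure_le _).2 fun s hs => Submodule.subset_span ⟨s, hs, rfl⟩
    exact this hz
  rw [eq_top_iff]
  rintro ⟨y, s⟩ -
  have : ((y, s) : Space q) = ∑ i, y i • latIncl q (Pi.single i 1, 0) + s • latIncl q (0, 1) := by
    refine Prod.ext ?_ ?_
    · ext j
      simp [latIncl, Prod.fst_sum, Finset.sum_apply, Pi.single_apply]
    · simp [latIncl, Prod.snd_sum]
  rw [this]
  exact Submodule.add_mem _ (Submodule.sum_mem _ fun i _ => Submodule.smul_mem _ _ (hall _))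
    (Submodule.smul_mem _ _ (hall _))

/-- The convex cone spans the whole space, hence has interior points. Such a point has positive
level and can be rescaled to level one. The statement concerns the cone before closure, whose points
are combinations of finitely many elements of `S`. -/
theorem exists_mem_interior_span {S : Set (Lat q)} {C : ℕ} (h : LinearlyBounded S C)
    (hG : group S = ⊤) :
    ∃ y : Fin q → ℝ,
      ((y, 1) : Space q) ∈ interior (Submodule.span ℝ≥0 (latIncl q '' S) : Set (Space q)) := by
  set P : Set (Space q) := (Submodule.span ℝ≥0 (latIncl q '' S) : Set (Space q)) with hP
  have hconv : Convex ℝ P := convex_span_nnreal _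
  have h0 : (0 : Space q) ∈ P := Submodule.zero_mem _
  have hne : (interior P).Nonempty := by
    rw [hconv.interior_nonempty_iff_affineSpan_eq_top,
      AffineSubspace.affineSpan_eq_top_iff_vectorSpan_eq_top_of_nonempty _ _ _ ⟨0, h0⟩,
      vectorSpan_eq_span_vsub_set_right ℝ h0, eq_top_iff, ← span_latIncl_eq_top hG]
    refine Submodule.span_mono fun x hx => ⟨x, Submodule.subset_span hx, by simp⟩
  obtain ⟨x, hx⟩ := hne
  -- An interior point of level zero could be pushed slightly downwards inside the cone, to a
  -- negative level.
  have hpos : 0 < x.2 := by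
    have hnn : ∀ y ∈ P, 0 ≤ y.2 := fun y hy => (h.cone_le (subset_closure hy)).1
    by_contra hle
    have hx2 : x.2 = 0 := le_antisymm (not_lt.1 hle) (hnn x (interior_subset hx))
    have hcont : Tendsto (fun ε : ℝ => x - ε • ((0, 1) : Space q)) (𝓝 0) (𝓝 x) := by
      have : Continuous fun ε : ℝ => x - ε • ((0, 1) : Space q) := by fun_prop
      simpa using this.tendsto 0
    obtain ⟨ε, hε, hε0⟩ := ((hcont.eventually (isOpen_interior.mem_nhds hx)).filter_mono
      nhdsWithin_le_nhds |>.and (self_mem_nhdsWithin : Set.Ioi (0 : ℝ) ∈ 𝓝[>] 0)).exists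
    have := hnn _ (interior_subset hε)
    simp [hx2] at this
    exact absurd hε0 (not_lt.2 this)
  refine ⟨x.2⁻¹ • x.1, ?_⟩
  have hsm : x.2⁻¹ • x ∈ interior (x.2⁻¹ • P) := by
    rw [interior_smul₀ (inv_ne_zero hpos.ne')]
    exact Set.smul_mem_smul_set hx
  have hsub : x.2⁻¹ • P ⊆ P := by
    rintro _ ⟨y, hy, rfl⟩
    exact Submodule.smul_mem _ (⟨x.2⁻¹, (inv_pos.2 hpos).le⟩ : ℝ≥0) hy
  have := interior_mono hsub hsm
  rwa [show x.2⁻¹ • x = (x.2⁻¹ • x.1, 1) from Prod.ext rfl (by simp [hpos.ne'])] at this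

theorem exists_sub_of_mem_closure {G : Type*} [AddCommGroup G] (S : AddSubmonoid G) {z : G}
    (hz : z ∈ AddSubgroup.closure (S : Set G)) : ∃ a ∈ S, ∃ b ∈ S, z = a - b := by
  induction hz using AddSubgroup.closure_induction with
  | mem x hx => exact ⟨x, hx, 0, S.zero_mem, by simp⟩
  | zero => exact ⟨0, S.zero_mem, 0, S.zero_mem, by simp⟩
  | add x y _ _ hx hy =>
    obtain ⟨a, ha, b, hb, rfl⟩ := hx
    obtain ⟨c, hc, d, hd, rfl⟩ := hy
    exact ⟨a + c, S.add_mem ha hc, b + d, S.add_mem hb hd, by abel⟩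
  | neg x _ hx =>
    obtain ⟨a, ha, b, hb, rfl⟩ := hx
    exact ⟨b, hb, a, ha, by abel⟩

theorem latIncl_injective : Function.Injective (latIncl q) := by
  intro x y h
  obtain ⟨h1, h2⟩ := Prod.mk.inj h
  refine Prod.ext ?_ (by exact_mod_cast h2)
  ext i
  exact_mod_cast congrFun h1 i

/-- A translate of the lattice points of a finitely generated subcone lies in the semigroup. -/
theorem exists_add_mem_of_mem_span (S : AddSubmonoid (Lat q)) (hG : group (S : Set (Lat q)) = ⊤)
    (T : Finset (Lat q)) (hT : (T : Set (Lat q)) ⊆ S) :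
    ∃ b : Lat q, ∀ z : Lat q, latIncl q z ∈ Submodule.span ℝ≥0 (latIncl q '' (T : Set (Lat q))) →
      z + b ∈ S := by
  classical
  -- The lattice points of the zonotope spanned by `T`: all remainders that can occur when the
  -- coefficients of a combination of `T` are rounded down. They are finite in number.
  set R : Set (Lat q) := {r | ∃ θ : Lat q → ℝ, (∀ t, 0 ≤ θ t ∧ θ t ≤ 1) ∧
    latIncl q r = ∑ t ∈ T, θ t • latIncl q t} with hR
  have hRfin : R.Finite := by
    set B : Lat q := ∑ t ∈ T, |t| with hB
    refine (Set.finite_Icc (-B) B).subset ?_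
    rintro r ⟨θ, hθ, hr⟩
    have hbound : ∀ g : Lat q → ℤ, |∑ t ∈ T, θ t * (g t : ℝ)| ≤ ((∑ t ∈ T, |g t| : ℤ) : ℝ) := by
      intro g
      push_cast
      refine (Finset.abs_sum_le_sum_abs _ _).trans (Finset.sum_le_sum fun t _ => ?_)
      rw [abs_mul, abs_of_nonneg (hθ t).1]
      exact mul_le_of_le_one_left (abs_nonneg _) (hθ t).2
    have h1 : ∀ i, |r.1 i| ≤ B.1 i := by
      intro i
      have hri : (r.1 i : ℝ) = ∑ t ∈ T, θ t * (t.1 i : ℝ) := by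
        have := congrArg (fun x : Space q => x.1 i) hr
        simpa [latIncl, Prod.fst_sum, Finset.sum_apply] using this
      have := hbound fun t => t.1 i
      rw [← hri] at this
      have h' : |r.1 i| ≤ ∑ t ∈ T, |t.1 i| := by exact_mod_cast this
      rw [hB, Prod.fst_sum, Finset.sum_apply]
      exact h'
    have h2 : |r.2| ≤ B.2 := by
      have hri : (r.2 : ℝ) = ∑ t ∈ T, θ t * (t.2 : ℝ) := by
        have := congrArg (fun x : Space q => x.2) hr
        simpa [latIncl, Prod.snd_sum] using this
      have := hbound fun t => t.2
      rw [← hri] at this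
      have h' : |r.2| ≤ ∑ t ∈ T, |t.2| := by exact_mod_cast this
      rw [hB, Prod.snd_sum]
      exact h'
    exact ⟨⟨fun i => (abs_le.1 (h1 i)).1, (abs_le.1 h2).1⟩,
      ⟨fun i => (abs_le.1 (h1 i)).2, (abs_le.1 h2).2⟩⟩
  have hdiff : ∀ r : Lat q, ∃ b ∈ S, r + b ∈ S := by
    intro r
    obtain ⟨a, ha, b, hb, rfl⟩ := exists_sub_of_mem_closure S
      (show r ∈ group (S : Set (Lat q)) from hG ▸ AddSubgroup.mem_top r)
    exact ⟨b, hb, by simpa using ha⟩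
  choose β hβ hrβ using hdiff
  -- Each remainder `r` is moved into `S` by some `β r ∈ S`. Adding all of them gives a shift
  -- independent of `z`; the unneeded terms are harmless because they lie in `S`.
  refine ⟨∑ r ∈ hRfin.toFinset, β r, fun z hz => ?_⟩
  rw [Submodule.mem_span_image_finset_iff_exists_fun] at hz
  obtain ⟨c', hc'⟩ := hz
  set c : Lat q → ℝ≥0 := fun t => if h : t ∈ T then c' ⟨t, h⟩ else 0 with hcdef
  have hc : ∑ t ∈ T, c t • latIncl q t = latIncl q z := by
    rw [← hc', ← Finset.sum_coe_sort]
    exact Finset.sum_congr rfl fun t _ => by simp [hcdef]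
  set w : Lat q := ∑ t ∈ T, ⌊(c t : ℝ)⌋₊ • t with hw
  have hwS : w ∈ S := S.sum_mem fun t ht => S.nsmul_mem (hT ht) _
  have hr : z - w ∈ R := by
    refine ⟨fun t => (c t : ℝ) - ⌊(c t : ℝ)⌋₊, fun t => ⟨?_, ?_⟩, ?_⟩
    · exact sub_nonneg.2 (Nat.floor_le (c t).2)
    · have := Nat.lt_floor_add_one (c t : ℝ)
      linarith
    · rw [map_sub, ← hc, hw, map_sum, ← Finset.sum_sub_distrib]
      refine Finset.sum_congr rfl fun t _ => ?_
      rw [map_nsmul, sub_smul, Nat.cast_smul_eq_nsmul]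
      rfl
  have hmem : z - w ∈ hRfin.toFinset := hRfin.mem_toFinset.2 hr
  rw [← Finset.add_sum_erase _ _ hmem]
  have : z + (β (z - w) + ∑ r ∈ hRfin.toFinset.erase (z - w), β r) =
      w + ((z - w) + β (z - w)) + ∑ r ∈ hRfin.toFinset.erase (z - w), β r := by abel
  rw [this]
  exact S.add_mem (S.add_mem hwS (hrβ _)) (S.sum_mem fun r _ => hβ r)

/-- The lattice points of large dilations of a compact convex set in the interior of the section
at level one belong to the semigroup. -/
theorem exists_latPts_subset_levelPts (S : AddSubmonoid (Lat q))
    (hG : group (S : Set (Lat q)) = ⊤) {K : Set (Fin q → ℝ)} (hK : IsCompact K)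
    (hKc : Convex ℝ K) (hKS : ∀ y ∈ K, ((y, 1) : Space q) ∈
      interior (Submodule.span ℝ≥0 (latIncl q '' (S : Set (Lat q))) : Set (Space q))) :
    ∃ p₀ : ℕ, ∀ p ≥ p₀, latPts K p ⊆ levelPts (S : Set (Lat q)) p := by
  classical
  have hK1 : IsCompact (K ×ˢ ({1} : Set ℝ)) := hK.prod isCompact_singleton
  have hK1c : Convex ℝ (K ×ˢ ({1} : Set ℝ)) := hKc.prod (convex_singleton 1)
  have hnhds : interior (Submodule.span ℝ≥0 (latIncl q '' (S : Set (Lat q))) : Set (Space q)) ∈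
      𝓝ˢ (K ×ˢ ({1} : Set ℝ)) := by
    rw [isOpen_interior.mem_nhdsSet]
    rintro ⟨y, s⟩ ⟨hy, hs⟩
    rw [Set.mem_singleton_iff] at hs
    subst hs
    exact hKS y hy
  -- The cone of `S` need not be finitely generated. A polytope around `K × {1}` inside it has
  -- vertices involving only finitely many elements of `S`, to which the uniform shift applies.
  obtain ⟨u, hu1, hu2⟩ := hK1c.exists_subset_interior_convexHull_finset_of_isCompact hK1 hnhds
  have hvert : ∀ x ∈ u, ∃ T : Finset (Lat q), (T : Set (Lat q)) ⊆ S ∧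
      x ∈ Submodule.span ℝ≥0 (latIncl q '' (T : Set (Lat q))) := by
    intro x hx
    have hx' : x ∈ Submodule.span ℝ≥0 (latIncl q '' (S : Set (Lat q))) :=
      interior_subset (hu2 (subset_convexHull ℝ _ hx))
    obtain ⟨T', hT', hxT'⟩ := Submodule.mem_span_finite_of_mem_span hx'
    obtain ⟨T, hT, rfl⟩ := Finset.subset_set_image_iff.1 hT'
    exact ⟨T, hT, by simpa using hxT'⟩
  choose! T hTS hTx using hvert
  set T' := u.biUnion T with hT'
  have hhull : convexHull ℝ (u : Set (Space q)) ⊆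
      Submodule.span ℝ≥0 (latIncl q '' (T' : Set (Lat q))) := by
    refine convexHull_min (fun x hx => ?_) (convex_span_nnreal _)
    refine Submodule.span_mono (Set.image_mono ?_) (hTx x hx)
    exact Finset.coe_subset.2 (Finset.subset_biUnion_of_mem T hx)
  obtain ⟨b, hb⟩ := exists_add_mem_of_mem_span S hG T' (by
    intro t ht
    obtain ⟨x, hx, hxt⟩ := Finset.mem_biUnion.1 (Finset.mem_coe.1 ht)
    exact hTS x hx hxt)
  obtain ⟨δ, hδ, hsub⟩ := hK1.exists_thickening_subset_open isOpen_interior hu1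
  obtain ⟨p₀, hp₀⟩ := exists_nat_gt (‖latIncl q b‖ / δ)
  refine ⟨p₀ + 1, fun p hp z hz => ?_⟩
  obtain ⟨y, hy, hzy⟩ := hz
  have hp0 : (0 : ℝ) < p := by
    have : 0 < p := by lia
    exact_mod_cast this
  have hlt : ‖latIncl q b‖ / p < δ := by
    rw [div_lt_iff₀ hp0]
    rw [div_lt_iff₀ hδ] at hp₀
    have : (p₀ : ℝ) ≤ p := by exact_mod_cast (by lia : p₀ ≤ p)
    nlinarith
  -- At level `p` the shift by `b` has relative size `‖b‖ / p`, below the margin `δ`. Hence `(z, p)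
  -- - b` still lies over the polytope, and adding `b` back lands in `S`.
  have hin : ((y, 1) : Space q) - (p : ℝ)⁻¹ • latIncl q b ∈ interior (convexHull ℝ ↑u) := by
    refine hsub (Metric.mem_thickening_iff.2 ⟨(y, 1), ⟨hy, rfl⟩, ?_⟩)
    rw [dist_eq_norm, sub_sub_cancel_left, norm_neg, norm_smul, norm_inv, Real.norm_natCast,
      inv_mul_eq_div]
    exact hlt
  have hin' := Submodule.smul_mem _ (p : ℝ≥0) (hhull (interior_subset hin))
  have heq : (p : ℝ≥0) • (((y, 1) : Space q) - (p : ℝ)⁻¹ • latIncl q b) =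
      latIncl q ((z, (p : ℤ)) - b) := by
    have h1 : (p : ℝ≥0) • (((y, 1) : Space q) - (p : ℝ)⁻¹ • latIncl q b) =
      (p : ℝ) • (((y, 1) : Space q) - (p : ℝ)⁻¹ • latIncl q b) := rfl
    rw [h1, smul_sub, smul_smul, mul_inv_cancel₀ hp0.ne', one_smul, map_sub]
    congr 1
    refine Prod.ext ?_ ?_
    · ext i
      simp [latIncl, hzy]
    · simp [latIncl]
  rw [heq] at hin'
  have := hb _ hin'
  rwa [sub_add_cancel] at this

/-- An integral vector is a sum of `t` integral vectors close to its `t`-th part. -/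
theorem exists_sum_eq_near (z : Fin q → ℤ) {t : ℕ} (ht : 0 < t) :
    ∃ f : ℕ → Fin q → ℤ, ∑ a ∈ Finset.range t, f a = z ∧
      ∀ a i, |(f a i : ℝ) - z i / t| ≤ 1 := by
  -- Euclidean division in each coordinate: the first `z i % t` summands receive an extra unit.
  refine ⟨fun a i => z i / t + if (a : ℤ) < z i % t then 1 else 0, ?_, fun a i => ?_⟩
  · ext i
    have hmod := Int.emod_nonneg (z i) (b := (t : ℤ)) (by lia)
    have hmod' := Int.emod_lt_of_pos (z i) (b := (t : ℤ)) (by lia)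
    obtain ⟨r, hr⟩ := Int.eq_ofNat_of_zero_le hmod
    rw [Finset.sum_apply, Finset.sum_add_distrib, Finset.sum_const, Finset.card_range, hr,
      Finset.sum_ite, Finset.sum_const_zero, Finset.sum_const]
    have : (Finset.range t).filter (fun a : ℕ => (a : ℤ) < (r : ℤ)) = Finset.range r := by
      ext a
      simp only [Finset.mem_filter, Finset.mem_range]
      lia
    rw [this, Finset.card_range]
    have := Int.mul_ediv_add_emod (z i) t
    simp only [nsmul_eq_mul, mul_one, add_zero]
    rw [hr] at this
    exact this
  · have ht' : (0 : ℝ) < t := by exact_mod_cast ht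
    have hmod := Int.emod_nonneg (z i) (b := (t : ℤ)) (by lia)
    have hmod' := Int.emod_lt_of_pos (z i) (b := (t : ℤ)) (by lia)
    have h := Int.mul_ediv_add_emod (z i) t
    have hR : (z i : ℝ) / t = (z i / t : ℤ) + ((z i % t : ℤ) : ℝ) / t := by
      have h' : (t : ℝ) * (z i / t : ℤ) + ((z i % t : ℤ) : ℝ) = z i := by exact_mod_cast h
      rw [← h']
      field_simp
    rw [hR]
    have h1 : (0 : ℝ) ≤ ((z i % t : ℤ) : ℝ) / t := div_nonneg (by exact_mod_cast hmod) ht'.le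
    have h2 : ((z i % t : ℤ) : ℝ) / t ≤ 1 := by
      rw [div_le_one ht']
      exact_mod_cast hmod'.le
    rw [abs_le]
    push_cast
    split_ifs <;> constructor <;> linarith

end FullSemigroup

/-! ### Inner approximation and growth of semigroups generating the lattice -/

section FullSemigroupGrowth

variable {q : ℕ}

/-- The lattice points of level `t * p` in the dilation of `K` are sums of points of level `p`. -/
theorem latPts_mul_subset_of_thickening {S : AddSubmonoid (Lat q)} {K K' : Set (Fin q → ℝ)} {δ : ℝ}
    (hKK' : Metric.thickening δ K ⊆ K') {p : ℕ} (hpδ : 1 < p * δ)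
    (hp : latPts K' p ⊆ levelPts (S : Set (Lat q)) p) {t : ℕ} (ht : 0 < t) :
    latPts K (t * p) ⊆ levelPts
      (AddSubmonoid.closure {s : Lat q | s ∈ S ∧ s.2 = p} : Set (Lat q)) (t * p) := by
  rintro z ⟨y, hy, hzy⟩
  obtain ⟨f, hf, hfz⟩ := exists_sum_eq_near z ht
  have hp0 : (0 : ℝ) < p := by
    rcases (Nat.cast_nonneg (α := ℝ) p).lt_or_eq with h | h
    · exact h
    · rw [← h, zero_mul] at hpδ
      exact absurd hpδ (by norm_num)
  have ht0 : (0 : ℝ) < t := by exact_mod_cast ht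
  have hδ : 0 < δ := by
    by_contra hle
    nlinarith [mul_nonneg hp0.le (sub_nonneg.2 (not_lt.1 hle))]
  -- Since `f a` is within `1` of `p * y`, the point `f a / p` is within `1 / p < δ` of `y`. This
  -- estimate does not depend on `t`.
  have hmem : ∀ a, (f a, (p : ℤ)) ∈ S := by
    intro a
    refine hp ⟨fun i => f a i / p, hKK' (Metric.mem_thickening_iff.2 ⟨y, hy, ?_⟩), fun i => ?_⟩
    · rw [dist_pi_lt_iff hδ]
      intro i
      have h1 := hfz a i
      rw [hzy, Nat.cast_mul] at h1
      have h2 : (t : ℝ) * p * y i / t = p * y i := by field_simp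
      rw [h2] at h1
      rw [Real.dist_eq, show (f a i : ℝ) / p - y i = (f a i - p * y i) / p by field_simp, abs_div,
        abs_of_pos hp0, div_lt_iff₀ hp0]
      linarith
    · field_simp
  have hsum : ((z, ((t * p : ℕ) : ℤ)) : Lat q) = ∑ a ∈ Finset.range t, (f a, (p : ℤ)) := by
    refine Prod.ext ?_ ?_
    · rw [Prod.fst_sum]; exact hf.symm
    · rw [Prod.snd_sum]; simp
  change ((z, ((t * p : ℕ) : ℤ)) : Lat q) ∈ AddSubmonoid.closure _
  rw [hsum]
  exact AddSubmonoid.sum_mem _ fun a _ => AddSubmonoid.subset_closure ⟨hmem a, rfl⟩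

/-- Inner approximation of the section of the cone by compact convex sets whose dilated lattice
points are sums of elements of one level of the semigroup. -/
theorem exists_inner_approximation (S : AddSubmonoid (Lat q)) {C : ℕ}
    (hC : LinearlyBounded (S : Set (Lat q)) C) (hG : group (S : Set (Lat q)) = ⊤)
    {r : ℝ} (hr0 : 0 < r) (hr1 : r < 1) :
    ∃ K : Set (Fin q → ℝ), IsCompact K ∧ Convex ℝ K ∧ (interior K).Nonempty ∧
      volume K = ENNReal.ofReal (r ^ q) * volume (section₁ (S : Set (Lat q))) ∧
      ∃ p₀ : ℕ, ∀ p ≥ p₀, ∀ t > 0, latPts K (t * p) ⊆ levelPts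
        (AddSubmonoid.closure {s : Lat q | s ∈ S ∧ s.2 = p} : Set (Lat q)) (t * p) := by
  obtain ⟨y₀, hy₀⟩ := exists_mem_interior_span hC hG
  set D := section₁ (S : Set (Lat q)) with hD
  have hDc : IsCompact D := hC.isCompact_section₁
  have hDconv : Convex ℝ D := convex_section₁ _
  have hy₀D : y₀ ∈ interior D := by
    have hcont : Continuous fun y : Fin q → ℝ => ((y, 1) : Space q) := by fun_prop
    refine (isOpen_interior.preimage hcont).subset_interior_iff.2 ?_ hy₀
    intro y hy
    exact subset_closure (interior_subset hy)
  set K : ℝ → Set (Fin q → ℝ) := fun r => AffineMap.homothety y₀ r '' D with hK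
  have hKc : ∀ r, IsCompact (K r) := fun r =>
    hDc.image (AffineMap.homothety y₀ r).continuous_of_finiteDimensional
  have hKconv : ∀ r, Convex ℝ (K r) := fun r => hDconv.affine_image _
  have hKint : ∀ r, 0 < r → y₀ ∈ interior (K r) := fun r hr =>
    ((AffineMap.homothety_isOpenMap y₀ r hr.ne').image_interior_subset _)
      ⟨y₀, hy₀D, by simp⟩
  -- A ratio strictly between `r` and `1`: `K r'` contains a neighbourhood of `K r`, leaving room
  -- for the rounding errors, and is itself in the interior of the cone.
  set r' := (r + 1) / 2 with hr'
  have hr'0 : 0 < r' := by positivity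
  have hr'1 : r' < 1 := by rw [hr']; linarith
  have hrr' : 1 < r' / r := by rw [one_lt_div hr0, hr']; linarith
  have hsub : K r ⊆ interior (K r') := by
    have h1 := (hKconv r).closure_subset_interior_image_homothety_of_one_lt (hKint r hr0) (r' / r)
      hrr'
    refine subset_closure.trans (h1.trans (interior_mono ?_))
    rw [hK]
    simp only [Set.image_image]
    rintro _ ⟨y, hy, rfl⟩
    refine ⟨y, hy, ?_⟩
    change _ = ((AffineMap.homothety y₀ (r' / r)).comp (AffineMap.homothety y₀ r)) y
    rw [← AffineMap.homothety_mul, div_mul_cancel₀ _ hr0.ne']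
  obtain ⟨δ, hδ, hthick⟩ := (hKc r).exists_thickening_subset_open isOpen_interior hsub
  obtain ⟨p₀, hp₀⟩ := exists_latPts_subset_levelPts S hG (hKc r') (hKconv r') (by
    rintro _ ⟨y, hy, rfl⟩
    -- The point `(y, 1)` is only known to lie in the closed cone; a proper combination with the
    -- interior point `y₀` is interior to the cone before closure.
    have := (convex_span_nnreal (latIncl q '' (S : Set (Lat q)))).combo_interior_closure_mem_interior
      hy₀ (show ((y, 1) : Space q) ∈ closure _ from hy) (sub_pos.2 hr'1) hr'0.le (by ring)
    convert this using 1
    refine Prod.ext ?_ (by simp)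
    rw [AffineMap.homothety_apply]
    ext i
    simp
    ring)
  obtain ⟨p₁, hp₁⟩ := exists_nat_gt (1 / δ)
  refine ⟨K r, hKc r, hKconv r, ⟨y₀, hKint r hr0⟩, ?_, max p₀ p₁, fun p hp t ht => ?_⟩
  · rw [hK, Measure.addHaar_image_homothety]
    simp [abs_of_pos hr0]
  · refine latPts_mul_subset_of_thickening (hthick.trans interior_subset) ?_
      (hp₀ p (le_of_max_le_left hp)) ht
    have : (p₁ : ℝ) ≤ p := by exact_mod_cast le_of_max_le_right hp
    rw [div_lt_iff₀ hδ] at hp₁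
    nlinarith

theorem finite_latPts {K : Set (Fin q → ℝ)} (hK : IsCompact K) (k : ℕ) : (latPts K k).Finite := by
  obtain ⟨R, hR⟩ := hK.isBounded.subset_closedBall (0 : Fin q → ℝ)
  obtain ⟨B, hB⟩ := exists_nat_gt (k * |R|)
  refine (Set.finite_Icc (fun _ => -(B : ℤ)) (fun _ => (B : ℤ))).subset ?_
  rintro z ⟨y, hy, hzy⟩
  have hyR : ∀ i, |y i| ≤ |R| := fun i =>
    (norm_le_pi_norm y i).trans ((mem_closedBall_zero_iff.1 (hR hy)).trans (le_abs_self R))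
  have : ∀ i, |z i| ≤ (B : ℤ) := by
    intro i
    have h1 : |(z i : ℝ)| ≤ B := by
      rw [hzy, abs_mul, Nat.abs_cast]
      exact (mul_le_mul_of_nonneg_left (hyR i) (Nat.cast_nonneg _)).trans hB.le
    exact_mod_cast h1
  exact ⟨fun i => (abs_le.1 (this i)).1, fun i => (abs_le.1 (this i)).2⟩

/-- The number of lattice points of the dilations of a compact convex set is asymptotically given
by its volume. -/
theorem hasGrowthCoeff_latPts {K : Set (Fin q → ℝ)} (hK : IsCompact K) (hKc : Convex ℝ K) :
    HasGrowthCoeff q (fun k => ((latPts K k).encard : ℝ≥0∞)) (volume K) := by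
  have h := tendsto_card_div_pow_atTop_volume K hK.isBounded hK.measurableSet
    (hKc.addHaar_frontier volume)
  have h' := ENNReal.tendsto_ofReal h
  rw [measureReal_def, ENNReal.ofReal_toReal hK.measure_lt_top.ne] at h'
  refine h'.congr' ?_
  filter_upwards [eventually_gt_atTop 0] with k hk
  have hk0 : (k : ℝ) ≠ 0 := by exact_mod_cast hk.ne'
  have hcard : Nat.card ↑(K ∩ (k : ℝ)⁻¹ • (Submodule.span ℤ (Set.range (Pi.basisFun ℝ (Fin q))) :
      Set (Fin q → ℝ))) = (latPts K k).ncard := by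
    rw [← Nat.card_coe_set_eq]
    have hmem : ∀ z : latPts K k, (fun i => (k : ℝ)⁻¹ * (z.1 i : ℝ)) ∈
        K ∩ (k : ℝ)⁻¹ • (Submodule.span ℤ (Set.range (Pi.basisFun ℝ (Fin q))) :
          Set (Fin q → ℝ)) := by
      intro z
      constructor
      · obtain ⟨y, hy, hzy⟩ := z.2
        convert hy using 1
        ext i
        rw [hzy]; field_simp
      · refine ⟨fun i => (z.1 i : ℝ), ?_, by ext i; simp⟩
        rw [SetLike.mem_coe, Module.Basis.mem_span_iff_repr_mem]
        intro i
        exact ⟨z.1 i, by simp⟩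
    refine (Nat.card_congr (Equiv.ofBijective (fun z : latPts K k => ⟨_, hmem z⟩) ⟨?_, ?_⟩)).symm
    · intro z w hzw
      refine Subtype.ext (funext fun i => ?_)
      have := congrFun (Subtype.ext_iff.1 hzw) i
      simpa [hk0] using this
    · rintro ⟨y, hy, x, hx, hxy⟩
      rw [SetLike.mem_coe, Module.Basis.mem_span_iff_repr_mem] at hx
      choose w hw using hx
      have hxy' : ∀ i, (k : ℝ)⁻¹ * x i = y i := fun i => congrFun hxy i
      have hw' : ∀ i, (w i : ℝ) = x i := fun i => by simpa using hw i
      refine ⟨⟨w, y, hy, fun i => ?_⟩, Subtype.ext (funext fun i => ?_)⟩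
      · rw [hw', ← hxy']; field_simp
      · simp only
        rw [hw', hxy']
  rw [hcard, ENNReal.ofReal_div_of_pos (by positivity), ENNReal.ofReal_natCast,
    ENNReal.ofReal_pow (Nat.cast_nonneg _), ENNReal.ofReal_natCast,
    ← (finite_latPts hK k).cast_ncard_eq, Fintype.card_fin, ENat.toENNReal_coe]

/-- A squeezing criterion with lower bounds indexed by a contraction ratio. -/
theorem tendsto_of_forall_ratio {f h : ℕ → ℝ≥0∞} {V : ℝ≥0∞} {d : ℕ} (hV : V ≠ ∞)
    (hlow : ∀ r : ℝ, 0 < r → r < 1 → ∃ g : ℕ → ℝ≥0∞,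
      Tendsto g atTop (𝓝 (ENNReal.ofReal (r ^ d) * V)) ∧ ∀ᶠ k in atTop, g k ≤ f k)
    (hh : Tendsto h atTop (𝓝 V)) (hup : ∀ᶠ k in atTop, f k ≤ h k) :
    Tendsto f atTop (𝓝 V) := by
  rw [tendsto_order]
  constructor
  · intro a ha
    have hcont : Tendsto (fun r : ℝ => ENNReal.ofReal (r ^ d) * V) (𝓝[<] 1) (𝓝 V) := by
      have h1 : Tendsto (fun r : ℝ => ENNReal.ofReal (r ^ d)) (𝓝[<] 1) (𝓝 1) := by
        have : Continuous fun r : ℝ => ENNReal.ofReal (r ^ d) :=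
          ENNReal.continuous_ofReal.comp (continuous_pow d)
        simpa using (this.tendsto 1).mono_left nhdsWithin_le_nhds
      simpa using ENNReal.Tendsto.mul_const h1 (Or.inr hV)
    obtain ⟨r, ⟨hr, hr0⟩, hr1⟩ := ((hcont.eventually (lt_mem_nhds ha)).and
      (nhdsWithin_le_nhds (lt_mem_nhds one_pos)) |>.and self_mem_nhdsWithin).exists
    obtain ⟨g, hg, hgf⟩ := hlow r hr0 hr1
    filter_upwards [hg.eventually (lt_mem_nhds hr), hgf] with k h1 h2 using h1.trans_le h2
  · intro b hb
    filter_upwards [hh.eventually (gt_mem_nhds hb), hup] with k h1 h2 using h2.trans_lt h1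

theorem levelPts_subset_latPts {S : Set (Lat q)} {k : ℕ} (hk : 0 < k) :
    levelPts S k ⊆ latPts (section₁ S) k := by
  intro z hz
  have hk0 : (0 : ℝ) < k := by exact_mod_cast hk
  refine ⟨fun i => (k : ℝ)⁻¹ * z i, subset_closure ?_, fun i => by field_simp⟩
  have h1 := Submodule.smul_mem _ (⟨(k : ℝ)⁻¹, by positivity⟩ : ℝ≥0)
    (Submodule.subset_span (R := ℝ≥0) ⟨(z, (k : ℤ)), hz, rfl⟩ :
      latIncl q (z, (k : ℤ)) ∈ Submodule.span ℝ≥0 (latIncl q '' S))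
  have heq : ((fun i => (k : ℝ)⁻¹ * (z i : ℝ), 1) : Space q) =
      (⟨(k : ℝ)⁻¹, by positivity⟩ : ℝ≥0) • latIncl q (z, (k : ℤ)) := by
    refine Prod.ext rfl ?_
    change (1 : ℝ) = (k : ℝ)⁻¹ * ((k : ℤ) : ℝ)
    rw [Int.cast_natCast]
    field_simp
  rw [heq]
  exact h1

theorem encard_ennreal_mono {α : Type*} {s t : Set α} (h : s ⊆ t) :
    (s.encard : ℝ≥0∞) ≤ (t.encard : ℝ≥0∞) :=
  ENat.toENNReal_mono (Set.encard_le_encard h)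

/-- The growth of a semigroup generating the whole lattice. -/
theorem hasGrowthCoeff_levelPts (S : AddSubmonoid (Lat q)) {C : ℕ}
    (hC : LinearlyBounded (S : Set (Lat q)) C) (hG : group (S : Set (Lat q)) = ⊤) :
    HasGrowthCoeff q (fun k => ((levelPts (S : Set (Lat q)) k).encard : ℝ≥0∞))
      (volume (section₁ (S : Set (Lat q)))) := by
  have hD := hC.isCompact_section₁
  refine tendsto_of_forall_ratio (d := q) hD.measure_lt_top.ne ?_
    (hasGrowthCoeff_latPts hD (convex_section₁ _)) ?_
  · intro r hr0 hr1
    obtain ⟨K, hK, hKc, -, hvol, p₀, hp₀⟩ := exists_inner_approximation S hC hG hr0 hr1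
    refine ⟨_, hvol ▸ hasGrowthCoeff_latPts hK hKc, ?_⟩
    filter_upwards [eventually_ge_atTop p₀] with k hk
    refine ENNReal.div_le_div_right (encard_ennreal_mono fun z hz => ?_) _
    have h1 := hp₀ k hk 1 one_pos (by rwa [one_mul])
    rw [one_mul] at h1
    have hle : AddSubmonoid.closure {s : Lat q | s ∈ S ∧ s.2 = k} ≤ S :=
      (AddSubmonoid.closure_le).2 fun s hs => hs.1
    exact hle h1
  · filter_upwards [eventually_gt_atTop 0] with k hk
    exact ENNReal.div_le_div_right (encard_ennreal_mono (levelPts_subset_latPts hk)) _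

/-- High levels of the semigroup contain a point together with all its neighbours in the
coordinate directions. -/
theorem exists_mem_and_add_single_mem (S : AddSubmonoid (Lat q)) {C : ℕ}
    (hC : LinearlyBounded (S : Set (Lat q)) C) (hG : group (S : Set (Lat q)) = ⊤) :
    ∃ p₀ : ℕ, ∀ p ≥ p₀, ∃ z : Fin q → ℤ, (z, (p : ℤ)) ∈ S ∧
      ∀ i, (z + Pi.single i 1, (p : ℤ)) ∈ S := by
  obtain ⟨K, hK, hKc, ⟨y₀, hy₀⟩, -, p₀, hp₀⟩ :=
    exists_inner_approximation S hC hG (r := 1 / 2) (by norm_num) (by norm_num)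
  obtain ⟨δ, hδ, hball⟩ := Metric.mem_nhds_iff.1 (mem_interior_iff_mem_nhds.1 hy₀)
  obtain ⟨p₁, hp₁⟩ := exists_nat_gt (1 / δ)
  refine ⟨max p₀ p₁, fun p hp => ?_⟩
  have hp₁p : (p₁ : ℝ) ≤ p := by exact_mod_cast le_of_max_le_right hp
  have hp0 : (0 : ℝ) < p := lt_of_lt_of_le (lt_trans (by positivity) hp₁) hp₁p
  -- All lattice points within distance `1` of `p * y₀` in every coordinate lie in `S`; rounding `p
  -- * y₀` down produces the point, and raising a coordinate by one stays within this distance.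
  have hnear : ∀ w : Fin q → ℤ, (∀ i, |(w i : ℝ) - p * y₀ i| ≤ 1) → (w, (p : ℤ)) ∈ S := by
    intro w hw
    have h1 := hp₀ p (le_of_max_le_left hp) 1 one_pos (a := w) (by
      rw [one_mul]
      refine ⟨fun i => w i / p, hball (Metric.mem_ball.2 ((dist_pi_lt_iff hδ).2 fun i => ?_)),
        fun i => by field_simp⟩
      rw [Real.dist_eq, show (w i : ℝ) / p - y₀ i = (w i - p * y₀ i) / p by field_simp, abs_div,
        abs_of_pos hp0, div_lt_iff₀ hp0]
      rw [div_lt_iff₀ hδ] at hp₁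
      nlinarith [hw i])
    rw [one_mul] at h1
    have hle : AddSubmonoid.closure {s : Lat q | s ∈ S ∧ s.2 = p} ≤ S :=
      (AddSubmonoid.closure_le).2 fun s hs => hs.1
    exact hle h1
  refine ⟨fun i => ⌊(p : ℝ) * y₀ i⌋, hnear _ fun i => ?_, fun j => hnear _ fun i => ?_⟩
  · have h1 := Int.floor_le ((p : ℝ) * y₀ i)
    have h2 := Int.lt_floor_add_one ((p : ℝ) * y₀ i)
    rw [abs_le]; constructor <;> linarith
  · have h1 := Int.floor_le ((p : ℝ) * y₀ i)
    have h2 := Int.lt_floor_add_one ((p : ℝ) * y₀ i)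
    rw [Pi.add_apply, Pi.single_apply]
    push_cast
    rw [abs_le]
    split_ifs <;> constructor <;> linarith

end FullSemigroupGrowth

/-! ### Integral volume and lattice index -/

section IntegralVolume

variable {n q : ℕ}

theorem discreteTopology_of_norm_lt_one {E : Type*} [NormedAddCommGroup E] (L : Submodule ℤ E)
    (h : ∀ x ∈ L, ‖x‖ < 1 → x = 0) : DiscreteTopology L := by
  refine discreteTopology_of_isOpen_singleton_zero (Metric.isOpen_singleton_iff.2
    ⟨1, one_pos, fun y hy => Subtype.ext (h y y.2 ?_)⟩)
  rwa [dist_zero_right] at hy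

theorem latIncl_eq_zero_of_norm_lt_one {z : Lat n} (h : ‖latIncl n z‖ < 1) : z = 0 := by
  rw [Prod.norm_def, max_lt_iff, pi_norm_lt_iff one_pos] at h
  refine Prod.ext (funext fun i => ?_) ?_
  · have h1 := h.1 i
    simp only [latIncl, AddMonoidHom.coe_mk, ZeroHom.coe_mk, Real.norm_eq_abs] at h1
    exact Int.abs_lt_one_iff.1 (by exact_mod_cast h1)
  · have h1 := h.2
    simp only [latIncl, AddMonoidHom.coe_mk, ZeroHom.coe_mk, Real.norm_eq_abs] at h1
    exact Int.abs_lt_one_iff.1 (by exact_mod_cast h1)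

/-- Integral vectors that are independent over `ℤ` are independent over `ℝ`. -/
theorem linearIndependent_latIncl {c : Fin q → Lat n} (hc : LinearIndependent ℤ c) :
    LinearIndependent ℝ fun i => latIncl n (c i) := by
  have hZ : LinearIndependent ℤ fun i => latIncl n (c i) :=
    hc.map' (latIncl n).toIntLinearMap (LinearMap.ker_eq_bot.2 latIncl_injective)
  -- For a discrete subgroup, the integral rank equals the dimension of the real span; non-zero
  -- integral vectors have norm at least `1`, which gives discreteness.
  rw [linearIndependent_iff_card_eq_finrank_span, Real.finrank_eq_int_finrank_of_discrete,
    ← linearIndependent_iff_card_eq_finrank_span]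
  · exact hZ
  · refine discreteTopology_of_norm_lt_one _ fun x hx hx1 => ?_
    have : x ∈ LinearMap.range (latIncl n).toIntLinearMap := by
      refine Submodule.span_le.2 ?_ hx
      rintro _ ⟨i, rfl⟩
      exact ⟨c i, rfl⟩
    obtain ⟨z, rfl⟩ := this
    have := latIncl_eq_zero_of_norm_lt_one (z := z) hx1
    rw [this, map_zero]

/-- Haar measure pulled back from a subspace is only proportional to Lebesgue measure; this tracks
the factor. -/
theorem covolume_smul {E : Type*} [NormedAddCommGroup E] [MeasurableSpace E] [BorelSpace E]
    [NormedSpace ℝ E] [FiniteDimensional ℝ E] (L : Submodule ℤ E)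
    [DiscreteTopology L] [IsZLattice ℝ L] (μ : Measure E) [μ.IsAddHaarMeasure] {a : ℝ≥0∞}
    (ha0 : a ≠ 0) (ha : a ≠ ∞) :
    ZLattice.covolume L (a • μ) = a.toReal * ZLattice.covolume L μ := by
  have := Measure.IsAddHaarMeasure.smul μ ha0 ha
  rw [ZLattice.covolume_eq_measure_fundamentalDomain L (a • μ)
    (ZLattice.isAddFundamentalDomain (Module.Free.chooseBasis ℤ L) _),
    ZLattice.covolume_eq_measure_fundamentalDomain L μ
    (ZLattice.isAddFundamentalDomain (Module.Free.chooseBasis ℤ L) _), measureReal_def,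
    measureReal_def, Measure.smul_apply, smul_eq_mul, ENNReal.toReal_mul]

theorem covolume_span_basisFun : ZLattice.covolume
    (Submodule.span ℤ (Set.range (Pi.basisFun ℝ (Fin q)))) (volume : Measure (Fin q → ℝ)) = 1 := by
  rw [ZLattice.covolume_eq_measure_fundamentalDomain _ _
    (ZSpan.isAddFundamentalDomain (Pi.basisFun ℝ (Fin q)) volume), ZSpan.volume_real_fundamentalDomain]
  have : Matrix.of (Pi.basisFun ℝ (Fin q)) = 1 := by
    ext i j
    simp [Matrix.one_apply, Pi.single_apply, eq_comm]
  rw [this]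
  simp

/-- Comparison of the integral measure of the span of integral vectors with the Lebesgue measure
in the corresponding coordinates. -/
theorem integralMeasure_image {c : Fin q → Lat n}
    (hc : LinearIndependent ℝ fun i => latIncl n (c i)) {ψ : (Fin q → ℝ) →ₗ[ℝ] Space n}
    (hψ : ∀ y, ψ y = ∑ i, y i • latIncl n (c i)) :
    (AddSubgroup.closure (Set.range c)).relIndex
        ((LinearMap.range ψ).toAddSubgroup.comap (latIncl n)) ≠ 0 ∧
    ∀ X : Set (Fin q → ℝ), integralMeasure (LinearMap.range ψ) {y | (y : Space n) ∈ ψ '' X} =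
      ((AddSubgroup.closure (Set.range c)).relIndex
        ((LinearMap.range ψ).toAddSubgroup.comap (latIncl n)) : ℝ≥0∞) * volume X := by
  set G₀ := AddSubgroup.closure (Set.range c) with hG₀
  set E₀ := LinearMap.range ψ with hE₀
  set B := E₀.toAddSubgroup.comap (latIncl n) with hB
  have hinj : Function.Injective ψ := by
    rw [← LinearMap.ker_eq_bot, LinearMap.ker_eq_bot']
    intro y hy
    rw [hψ] at hy
    exact funext (Fintype.linearIndependent_iff.1 hc y hy)
  have hsingle : ∀ i, ψ (Pi.single i 1) = latIncl n (c i) := by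
    intro i
    rw [hψ]
    simp [Pi.single_apply]
  let e : (Fin q → ℝ) ≃L[ℝ] E₀ := (LinearEquiv.ofInjective ψ hinj).toContinuousLinearEquiv
  have he : ∀ y, ((e y : E₀) : Space n) = ψ y := fun y => rfl
  have hdisc : DiscreteTopology (integralPoints E₀) := by
    refine discreteTopology_of_norm_lt_one _ fun x hx hx1 => ?_
    obtain ⟨z, hz⟩ := hx
    have hz' : latIncl n z = (x : Space n) := hz
    have := latIncl_eq_zero_of_norm_lt_one (z := z) (by rw [hz']; exact hx1)
    rw [this, map_zero] at hz'
    exact Subtype.ext hz'.symm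
  have hlat : IsZLattice ℝ (integralPoints E₀) := by
    refine ⟨?_⟩
    rw [eq_top_iff]
    rintro x -
    obtain ⟨y, rfl⟩ := e.surjective x
    rw [← (Pi.basisFun ℝ (Fin q)).sum_repr y, map_sum]
    refine Submodule.sum_mem _ fun i _ => ?_
    rw [map_smul]
    refine Submodule.smul_mem _ _ (Submodule.subset_span ⟨c i, ?_⟩)
    rw [Pi.basisFun_apply]
    exact (hsingle i).symm
  -- In the coordinates given by `c`, the subgroup generated by `c` becomes the standard lattice
  -- `Λ₁`, and the integral points become a larger lattice `Λ₂`. The index is the ratio of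
  -- covolumes, `1 / covolume Λ₂`, which also shows that it is finite.
  set Λ₁ : Submodule ℤ (Fin q → ℝ) := Submodule.span ℤ (Set.range (Pi.basisFun ℝ (Fin q))) with hΛ₁
  set Λ₂ : Submodule ℤ (Fin q → ℝ) :=
    ZLattice.comap ℝ (integralPoints E₀) (e : (Fin q → ℝ) ≃ₗ[ℝ] E₀).toLinearMap with hΛ₂
  have hmem₂ : ∀ y, y ∈ Λ₂ ↔ ∃ z, latIncl n z = ψ y := fun y => Iff.rfl
  have hdisc₂ : DiscreteTopology Λ₂ := ZLattice.comap_discreteTopology ℝ _ e.continuous e.injective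
  have hlat₂ : IsZLattice ℝ Λ₂ := instIsZLatticeComap ℝ (integralPoints E₀) e
  have hle : Λ₁ ≤ Λ₂ := by
    rw [hΛ₁, Submodule.span_le]
    rintro _ ⟨i, rfl⟩
    exact (hmem₂ _).2 ⟨c i, by rw [Pi.basisFun_apply, hsingle]⟩
  have hindex : Λ₁.toAddSubgroup.relIndex Λ₂.toAddSubgroup = G₀.relIndex B := by
    rw [← AddSubgroup.relIndex_map_map_of_injective (f := ψ.toAddMonoidHom) _ _ hinj,
      ← AddSubgroup.relIndex_map_map_of_injective (f := latIncl n) G₀ B latIncl_injective]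
    congr 1
    · rw [hΛ₁, hG₀, Submodule.span_int_eq_addSubgroupClosure,
        AddMonoidHom.map_closure, AddMonoidHom.map_closure, ← Set.range_comp, ← Set.range_comp]
      congr 2
      ext1 i
      exact (congrArg ψ (Pi.basisFun_apply ℝ (Fin q) i)).trans (hsingle i)
    · ext x
      constructor
      · rintro ⟨y, hy, rfl⟩
        obtain ⟨z, hz⟩ := (hmem₂ y).1 hy
        exact ⟨z, ⟨y, hz.symm⟩, hz⟩
      · rintro ⟨z, ⟨y, hy⟩, rfl⟩
        exact ⟨y, (hmem₂ y).2 ⟨z, hy.symm⟩, hy⟩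
  have hcov₁ : ZLattice.covolume Λ₁ (volume : Measure (Fin q → ℝ)) = 1 := covolume_span_basisFun
  have hcov := ZLattice.covolume_div_covolume_eq_relIndex Λ₁ Λ₂ hle
  have hpos₂ := ZLattice.covolume_pos Λ₂ (volume : Measure (Fin q → ℝ))
  rw [hcov₁, hindex] at hcov
  have hne : G₀.relIndex B ≠ 0 := by
    intro h0
    rw [h0, Nat.cast_zero] at hcov
    exact (one_div_pos.2 hpos₂).ne' hcov
  refine ⟨hne, fun X => ?_⟩
  set μ : Measure E₀ := Measure.addHaar with hμ
  set ν : Measure (Fin q → ℝ) := μ.map e.symm with hν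
  have hνh : ν.IsAddHaarMeasure := e.symm.isAddHaarMeasure_map μ
  have hpres : MeasurePreserving e ν μ := by
    refine ⟨e.continuous.measurable, ?_⟩
    rw [hν, Measure.map_map e.continuous.measurable e.symm.continuous.measurable]
    simp
  -- The unknown proportionality factor `a` appears both in the measure and in the normalizing
  -- covolume, and cancels.
  obtain ⟨a, ha0, ha, hνa⟩ : ∃ a : ℝ≥0∞, a ≠ 0 ∧ a ≠ ∞ ∧ ν = a • (volume : Measure (Fin q → ℝ)) := by
    refine ⟨ν.addHaarScalarFactor volume, ?_, ENNReal.coe_ne_top, ?_⟩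
    · exact_mod_cast (Measure.addHaarScalarFactor_pos_of_isAddHaarMeasure ν volume).ne'
    · exact Measure.isAddLeftInvariant_eq_smul ν volume
  have hcovE : ZLattice.covolume (integralPoints E₀) μ =
      a.toReal * ZLattice.covolume Λ₂ (volume : Measure (Fin q → ℝ)) := by
    rw [← ZLattice.covolume_comap (integralPoints E₀) μ ν hpres, ← covolume_smul Λ₂ volume ha0 ha,
      ← hνa]
  have hset : {y : E₀ | (y : Space n) ∈ ψ '' X} = e '' X := by
    ext y
    constructor
    · rintro ⟨x, hx, hxy⟩
      exact ⟨x, hx, Subtype.ext hxy⟩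
    · rintro ⟨x, hx, rfl⟩
      exact ⟨x, hx, rfl⟩
  have hμX : μ (e '' X) = a * volume X := by
    have h1 : ν X = a * volume X := by rw [hνa, Measure.smul_apply, smul_eq_mul]
    rw [← h1, hν, e.image_eq_preimage_symm X]
    exact ((e.symm.toHomeomorph.toMeasurableEquiv).map_apply X).symm
  have hcov₂ : ENNReal.ofReal (ZLattice.covolume Λ₂ (volume : Measure (Fin q → ℝ))) =
      (G₀.relIndex B : ℝ≥0∞)⁻¹ := by
    rw [← ENNReal.ofReal_natCast, ← hcov, ← ENNReal.ofReal_inv_of_pos (one_div_pos.2 hpos₂), one_div,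
      inv_inv]
  have hN : (G₀.relIndex B : ℝ≥0∞) ≠ 0 := by exact_mod_cast hne
  rw [hset, integralMeasure, Measure.smul_apply, smul_eq_mul, hcovE, hμX,
    ENNReal.ofReal_mul ENNReal.toReal_nonneg, ENNReal.ofReal_toReal ha, hcov₂,
    ENNReal.mul_inv (Or.inl ha0) (Or.inl ha), inv_inv, mul_comm a⁻¹, mul_assoc, ← mul_assoc a⁻¹,
    ENNReal.inv_mul_cancel ha0 ha, one_mul]

/-- By translation invariance the choice of base point does not matter, so the supremum is over a
constant; `D` must be non-empty for it to be attained. -/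
theorem integralVolume_image {c : Fin q → Lat n}
    (hc : LinearIndependent ℝ fun i => latIncl n (c i)) {ψ : (Fin q → ℝ) →ₗ[ℝ] Space n}
    (hψ : ∀ y, ψ y = ∑ i, y i • latIncl n (c i)) (x₀ : Space n) {D : Set (Fin q → ℝ)}
    (hD : D.Nonempty) :
    integralVolume (LinearMap.range ψ) ((fun y => ψ y + x₀) '' D) =
      ((AddSubgroup.closure (Set.range c)).relIndex
        ((LinearMap.range ψ).toAddSubgroup.comap (latIncl n)) : ℝ≥0∞) * volume D := by
  have key : ∀ x ∈ (fun y => ψ y + x₀) '' D, integralMeasure (LinearMap.range ψ)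
      {y : LinearMap.range ψ | x + (y : Space n) ∈ (fun y => ψ y + x₀) '' D} =
      ((AddSubgroup.closure (Set.range c)).relIndex
        ((LinearMap.range ψ).toAddSubgroup.comap (latIncl n)) : ℝ≥0∞) * volume D := by
    rintro _ ⟨y₀, hy₀, rfl⟩
    have hvol : volume ((fun y => y₀ + y) ⁻¹' D) = volume D := measure_preimage_add _ _ _
    rw [← hvol, ← (integralMeasure_image hc hψ).2]
    congr 1
    ext y
    constructor
    · rintro ⟨w, hw, hwy⟩
      refine ⟨w - y₀, by simpa using hw, ?_⟩
      have hwy' : ψ w + x₀ = ψ y₀ + x₀ + (y : Space n) := hwy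
      rw [map_sub]
      have : ψ w = ψ y₀ + (y : Space n) := by
        apply add_right_cancel (b := x₀)
        rw [hwy']; abel
      rw [this]; abel
    · rintro ⟨w, hw, hwy⟩
      refine ⟨y₀ + w, hw, ?_⟩
      change ψ (y₀ + w) + x₀ = ψ y₀ + x₀ + (y : Space n)
      rw [← hwy, map_add]; abel
  obtain ⟨y₀, hy₀⟩ := hD
  refine le_antisymm (iSup₂_le fun x hx => (key x hx).le) ?_
  rw [← key _ ⟨y₀, hy₀, rfl⟩]
  exact le_iSup₂ (f := fun x (_ : x ∈ (fun y => ψ y + x₀) '' D) =>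
    integralMeasure (LinearMap.range ψ)
      {y : LinearMap.range ψ | x + (y : Space n) ∈ (fun y => ψ y + x₀) '' D}) _ ⟨y₀, hy₀, rfl⟩

end IntegralVolume

/-! ### Coordinates on the group generated by a semigroup -/

section Coordinates

variable {n : ℕ}

theorem mem_group₀ {S : Set (Lat n)} {z : Lat n} : z ∈ group₀ S ↔ z ∈ group S ∧ z.2 = 0 := Iff.rfl

/-- The rank of `G₀(S)`. -/
noncomputable def rank₀ (S : Set (Lat n)) : ℕ :=
  Module.finrank ℤ (AddSubgroup.toIntSubmodule (group₀ S))

theorem map_snd_group (S : Set (Lat n)) :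
    (group S).map (AddMonoidHom.snd (Fin n → ℤ) ℤ) = AddSubgroup.zmultiples (levelIndex S : ℤ) := by
  obtain ⟨a, ha⟩ := Int.subgroup_cyclic ((group S).map (AddMonoidHom.snd (Fin n → ℤ) ℤ))
  rw [← AddSubgroup.zmultiples_eq_closure] at ha
  rw [levelIndex, ha, Int.index_zmultiples, Int.zmultiples_natAbs]

theorem levelIndex_dvd {S : Set (Lat n)} {z : Lat n} (hz : z ∈ group S) :
    (levelIndex S : ℤ) ∣ z.2 := by
  rw [← Int.mem_zmultiples_iff, ← map_snd_group]
  exact ⟨z, hz, rfl⟩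

theorem levelIndex_pos {S : Set (Lat n)} {z : Lat n} (hz : z ∈ S) (hz0 : z.2 ≠ 0) :
    0 < levelIndex S := by
  rw [Nat.pos_iff_ne_zero]
  intro h0
  have := levelIndex_dvd (AddSubgroup.subset_closure hz : z ∈ group S)
  rw [h0, Nat.cast_zero, zero_dvd_iff] at this
  exact hz0 this

/-- The real extension of a homomorphism of lattices. -/
noncomputable def realExt {q : ℕ} (Φ : Lat q →+ Lat n) : Space q →ₗ[ℝ] Space n :=
  (Fintype.linearCombination ℝ fun i => latIncl n (Φ (Pi.single i 1, 0))).comp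
      (LinearMap.fst ℝ (Fin q → ℝ) ℝ) +
    (LinearMap.toSpanSingleton ℝ (Space n) (latIncl n (Φ (0, 1)))).comp
      (LinearMap.snd ℝ (Fin q → ℝ) ℝ)

theorem realExt_apply {q : ℕ} (Φ : Lat q →+ Lat n) (x : Space q) :
    realExt Φ x = ∑ i, x.1 i • latIncl n (Φ (Pi.single i 1, 0)) + x.2 • latIncl n (Φ (0, 1)) := by
  simp [realExt, Fintype.linearCombination_apply]

theorem realExt_latIncl {q : ℕ} (Φ : Lat q →+ Lat n) (z : Lat q) :
    realExt Φ (latIncl q z) = latIncl n (Φ z) := by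
  have hz : z = ∑ i, z.1 i • ((Pi.single i 1, 0) : Lat q) + z.2 • ((0, 1) : Lat q) := by
    refine Prod.ext ?_ ?_
    · ext j
      simp [Prod.fst_sum, Finset.sum_apply, Pi.single_apply]
    · simp [Prod.snd_sum]
  have hcast : ∀ (a : ℤ) (x : Space n), a • x = (a : ℝ) • x := fun a x =>
    (Int.cast_smul_eq_zsmul ℝ a x).symm
  rw [realExt_apply]
  conv_rhs => rw [hz]
  simp only [map_add, map_sum, map_zsmul, hcast]
  rfl

/-- The group generated by a semigroup with elements of positive level is coordinatized by
`ℤ^q × ℤ`, where the level becomes the last coordinate times `m(S)`. -/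
theorem exists_coordinates {S : Set (Lat n)} (hm : 0 < levelIndex S) :
    ∃ Φ : Lat (rank₀ S) →+ Lat n, Function.Injective (realExt Φ) ∧ Function.Injective Φ ∧
      (∀ x, (Φ x).2 = levelIndex S * x.2) ∧ Φ.range = group S ∧
      AddSubgroup.closure (Set.range fun i => Φ (Pi.single i 1, 0)) = group₀ S := by
  set M := AddSubgroup.toIntSubmodule (group₀ S) with hM
  have hfree : Module.Free ℤ M := inferInstance
  have hfin : Module.Finite ℤ M := inferInstance
  let b : Module.Basis (Fin (rank₀ S)) ℤ M := Module.finBasis ℤ M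
  obtain ⟨g, hg, hg2⟩ : ∃ g ∈ group S, g.2 = levelIndex S := by
    have : (levelIndex S : ℤ) ∈ (group S).map (AddMonoidHom.snd (Fin n → ℤ) ℤ) := by
      rw [map_snd_group]; exact AddSubgroup.mem_zmultiples _
    obtain ⟨g, hg, h⟩ := this
    exact ⟨g, hg, h⟩
  have hb0 : ∀ i, (b i : Lat n) ∈ group S ∧ (b i : Lat n).2 = 0 := fun i => mem_group₀.1 (b i).2
  -- A basis of `G₀` is completed by an element `g` of level `m`. Levels in `G` are multiples of
  -- `m`, so `G` is the direct sum of `G₀` and `ℤ g`.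
  let Φ : Lat (rank₀ S) →+ Lat n :=
    { toFun := fun x => ((Fintype.linearCombination ℤ fun i => (b i : Lat n)) x.1) + x.2 • g
      map_zero' := by simp
      map_add' := fun x y => by simp only [Prod.fst_add, Prod.snd_add, map_add, add_smul]; abel }
  have hΦ : ∀ x : Lat (rank₀ S), Φ x = ∑ i, x.1 i • (b i : Lat n) + x.2 • g := fun x => by
    simp [Φ, Fintype.linearCombination_apply]
  have hΦ1 : ∀ i, Φ (Pi.single i 1, 0) = b i := fun i => by
    rw [hΦ]; simp [Pi.single_apply]
  have hΦ2 : Φ (0, 1) = g := by rw [hΦ]; simp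
  have hlevel : ∀ x, (Φ x).2 = levelIndex S * x.2 := by
    intro x
    rw [hΦ, Prod.snd_add, Prod.snd_sum, Finset.sum_eq_zero fun i _ => by
      rw [Prod.smul_snd, (hb0 i).2, smul_zero], Prod.smul_snd, hg2, smul_eq_mul, zero_add, mul_comm]
  have hli : LinearIndependent ℝ fun i => latIncl n (b i) := by
    refine linearIndependent_latIncl ?_
    exact b.linearIndependent.map' M.subtype M.ker_subtype
  have hinjR : Function.Injective (realExt Φ) := by
    rw [← LinearMap.ker_eq_bot, LinearMap.ker_eq_bot']
    intro x hx
    rw [realExt_apply] at hx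
    simp only [hΦ1, hΦ2] at hx
    have h2 : x.2 = 0 := by
      have h3 := congrArg Prod.snd hx
      rw [Prod.snd_add, Prod.snd_sum] at h3
      simp only [Prod.smul_snd, latIncl, AddMonoidHom.coe_mk, ZeroHom.coe_mk, (hb0 _).2, hg2] at h3
      simpa [hm.ne'] using h3
    rw [h2, zero_smul, add_zero] at hx
    exact Prod.ext (funext (Fintype.linearIndependent_iff.1 hli x.1 hx)) h2
  have hrange0 : AddSubgroup.closure (Set.range fun i => Φ (Pi.single i 1, 0)) = group₀ S := by
    have h1 : (Submodule.span ℤ (Set.range b)).map M.subtype = M := by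
      rw [b.span_eq, Submodule.map_top, Submodule.range_subtype]
    rw [Submodule.map_span, ← Set.range_comp] at h1
    have h2 := congrArg Submodule.toAddSubgroup h1
    rw [Submodule.span_int_eq_addSubgroupClosure] at h2
    simp only [hΦ1]
    exact h2
  refine ⟨Φ, hinjR, fun x y hxy => ?_, hlevel, le_antisymm ?_ ?_, hrange0⟩
  · exact latIncl_injective (hinjR (by rw [realExt_latIncl, realExt_latIncl, hxy]))
  · rintro _ ⟨x, rfl⟩
    rw [hΦ]
    exact add_mem (sum_mem fun i _ => zsmul_mem (hb0 i).1 _) (zsmul_mem hg _)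
  · intro z hz
    obtain ⟨s, hs⟩ := levelIndex_dvd hz
    have h0 : z - s • g ∈ group₀ S := by
      refine mem_group₀.2 ⟨sub_mem hz (zsmul_mem hg _), ?_⟩
      rw [Prod.snd_sub, Prod.smul_snd, hg2, hs, smul_eq_mul]; ring
    rw [← hrange0] at h0
    have h1 : AddSubgroup.closure (Set.range fun i => Φ (Pi.single i 1, 0)) ≤ Φ.range := by
      rw [AddSubgroup.closure_le]
      rintro _ ⟨i, rfl⟩
      exact ⟨_, rfl⟩
    have h3 : g ∈ Φ.range := ⟨(0, 1), hΦ2⟩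
    have h2 : s • g ∈ Φ.range := zsmul_mem h3 s
    simpa using add_mem (h1 h0) h2

/-- The properties of a semigroup transported to coordinates of the group it generates. -/
structure IsCoordinates (S : AddSubmonoid (Lat n)) (Φ : Lat (rank₀ (S : Set (Lat n))) →+ Lat n) :
    Prop where
  injective : Function.Injective Φ
  level : ∀ x, (Φ x).2 = levelIndex (S : Set (Lat n)) * x.2
  range_eq : Φ.range = group (S : Set (Lat n))
  closure_range : AddSubgroup.closure (Set.range fun i => Φ (Pi.single i 1, 0)) =
    group₀ (S : Set (Lat n))
  group_comap : group (Φ ⁻¹' (S : Set (Lat n))) = ⊤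
  bounded : ∃ C, LinearlyBounded (Φ ⁻¹' (S : Set (Lat n))) C

theorem image_comap_of_le_range {q : ℕ} {S : Set (Lat n)} {Φ : Lat q →+ Lat n}
    (hr : Φ.range = group S) : Φ '' (Φ ⁻¹' S) = S := by
  rw [Set.image_preimage_eq_iff]
  intro s hs
  have : s ∈ Φ.range := hr ▸ AddSubgroup.subset_closure hs
  exact this

theorem realSpan_eq_range {q : ℕ} {S : Set (Lat n)} {Φ : Lat q →+ Lat n}
    (hr : Φ.range = group S) (hG : group (Φ ⁻¹' S) = ⊤) :
    realSpan S = LinearMap.range (realExt Φ) := by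
  rw [realSpan, LinearMap.range_eq_map, ← span_latIncl_eq_top hG, Submodule.map_span]
  congr 1
  conv_lhs => rw [← image_comap_of_le_range hr]
  rw [Set.image_image, Set.image_image]
  simp only [realExt_latIncl]

/-- An injective linear map of finite dimensional spaces is a closed embedding, so it commutes with
the closure in the definition of the cone. -/
theorem cone_eq_image {q : ℕ} {S : Set (Lat n)} {Φ : Lat q →+ Lat n}
    (hr : Φ.range = group S) (hinj : Function.Injective (realExt Φ)) :
    cone S = realExt Φ '' cone (Φ ⁻¹' S) := by
  have hcl := LinearMap.isClosedEmbedding_of_injective (LinearMap.ker_eq_bot.2 hinj)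
  rw [cone, cone, ← hcl.closure_image_eq]
  congr 1
  conv_lhs => rw [← image_comap_of_le_range hr]
  have h1 := Submodule.map_span ((realExt Φ).restrictScalars ℝ≥0) (latIncl q '' (Φ ⁻¹' S))
  have h2 := congrArg (fun N : Submodule ℝ≥0 (Space n) => (N : Set (Space n))) h1
  simp only [Submodule.map_coe, LinearMap.coe_restrictScalars] at h2
  rw [h2, Set.image_image, Set.image_image]
  simp only [realExt_latIncl]

/-- The linear part of the parametrization of the hyperplanes of constant level. -/
noncomputable def levelMap {q : ℕ} (Φ : Lat q →+ Lat n) : (Fin q → ℝ) →ₗ[ℝ] Space n :=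
  (realExt Φ).comp (LinearMap.inl ℝ (Fin q → ℝ) ℝ)

theorem levelMap_apply {q : ℕ} (Φ : Lat q →+ Lat n) (y : Fin q → ℝ) :
    levelMap Φ y = ∑ i, y i • latIncl n (Φ (Pi.single i 1, 0)) := by
  simp [levelMap, realExt_apply]

theorem realExt_eq_levelMap {q : ℕ} (Φ : Lat q →+ Lat n) (y : Fin q → ℝ) (s : ℝ) :
    realExt Φ (y, s) = levelMap Φ y + s • latIncl n (Φ (0, 1)) := by
  rw [levelMap_apply, realExt_apply]

theorem levelMap_snd {q : ℕ} {Φ : Lat q →+ Lat n} {m : ℤ} (hl : ∀ x, (Φ x).2 = m * x.2)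
    (y : Fin q → ℝ) : (levelMap Φ y).2 = 0 := by
  rw [levelMap_apply, Prod.snd_sum]
  refine Finset.sum_eq_zero fun i _ => ?_
  simp [latIncl, hl]

theorem realExt_snd {q : ℕ} {Φ : Lat q →+ Lat n} {m : ℤ} (hl : ∀ x, (Φ x).2 = m * x.2)
    (x : Space q) : (realExt Φ x).2 = m * x.2 := by
  rw [show x = (x.1, x.2) from rfl, realExt_eq_levelMap, Prod.snd_add, levelMap_snd hl]
  simp [latIncl, hl, mul_comm]

theorem body_eq_image {q : ℕ} {S : Set (Lat n)} {Φ : Lat q →+ Lat n} (hm : 0 < levelIndex S)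
    (hr : Φ.range = group S) (hinj : Function.Injective (realExt Φ))
    (hl : ∀ x, (Φ x).2 = levelIndex S * x.2) :
    body S = (fun y => levelMap Φ y + latIncl n (Φ (0, 1))) '' section₁ (Φ ⁻¹' S) := by
  have hm' : (levelIndex S : ℝ) ≠ 0 := by exact_mod_cast hm.ne'
  ext x
  constructor
  · rintro ⟨hx, hx2⟩
    rw [cone_eq_image hr hinj] at hx
    obtain ⟨⟨y, s⟩, hy, rfl⟩ := hx
    rw [realExt_snd hl, Int.cast_natCast, mul_eq_left₀ hm'] at hx2
    simp only at hx2
    subst hx2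
    exact ⟨y, hy, by rw [realExt_eq_levelMap, one_smul]⟩
  · rintro ⟨y, hy, rfl⟩
    have h1 : levelMap Φ y + latIncl n (Φ (0, 1)) = realExt Φ (y, 1) := by
      rw [realExt_eq_levelMap, one_smul]
    refine ⟨?_, ?_⟩
    · rw [cone_eq_image hr hinj]
      exact ⟨_, hy, h1.symm⟩
    · simp only
      rw [h1, realExt_snd hl]
      simp

/-- This describes the direction space of the level hyperplanes by `G₀` alone, so two semigroups
with equal `G₀` can be compared. -/
theorem range_levelMap {q : ℕ} {S : Set (Lat n)} {Φ : Lat q →+ Lat n}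
    (h0 : AddSubgroup.closure (Set.range fun i => Φ (Pi.single i 1, 0)) = group₀ S) :
    LinearMap.range (levelMap Φ) = Submodule.span ℝ (latIncl n '' (group₀ S)) := by
  refine le_antisymm ?_ (Submodule.span_le.2 ?_)
  · rintro _ ⟨y, rfl⟩
    rw [levelMap_apply]
    refine Submodule.sum_mem _ fun i _ => Submodule.smul_mem _ _ (Submodule.subset_span ⟨_, ?_, rfl⟩)
    rw [← h0]
    exact AddSubgroup.subset_closure ⟨i, rfl⟩
  · rintro _ ⟨z, hz, rfl⟩
    rw [← h0] at hz
    have : AddSubgroup.closure (Set.range fun i => Φ (Pi.single i 1, 0)) ≤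
        (LinearMap.range (levelMap Φ)).toAddSubgroup.comap (latIncl n) := by
      rw [AddSubgroup.closure_le]
      rintro _ ⟨i, rfl⟩
      refine ⟨Pi.single i 1, ?_⟩
      rw [levelMap_apply]
      simp [Pi.single_apply]
    exact this hz

theorem boundaryLattice_eq {q : ℕ} {S : Set (Lat n)} {Φ : Lat q →+ Lat n} (hm : 0 < levelIndex S)
    (hr : Φ.range = group S) (hG : group (Φ ⁻¹' S) = ⊤) (hl : ∀ x, (Φ x).2 = levelIndex S * x.2) :
    boundaryLattice S = (LinearMap.range (levelMap Φ)).toAddSubgroup.comap (latIncl n) := by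
  have hm' : (levelIndex S : ℝ) ≠ 0 := by exact_mod_cast hm.ne'
  ext z
  constructor
  · rintro ⟨hz, hz2⟩
    have hz' : latIncl n z ∈ realSpan S := hz
    rw [realSpan_eq_range hr hG] at hz'
    obtain ⟨⟨y, s⟩, hy⟩ := hz'
    have h2 := congrArg Prod.snd hy
    rw [realExt_snd hl] at h2
    have hz0 : z.2 = 0 := hz2
    have hs : s = 0 := by
      simpa [latIncl, hz0, hm.ne'] using h2
    subst hs
    rw [realExt_eq_levelMap, zero_smul, add_zero] at hy
    exact ⟨y, hy⟩
  · rintro ⟨y, hy⟩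
    refine ⟨?_, ?_⟩
    · change latIncl n z ∈ realSpan S
      rw [realSpan_eq_range hr hG]
      exact ⟨(y, 0), by rw [realExt_eq_levelMap, zero_smul, add_zero]; exact hy⟩
    · have h2 : (levelMap Φ y).2 = (z.2 : ℝ) := congrArg Prod.snd hy
      rw [levelMap_snd hl] at h2
      exact_mod_cast h2.symm

/-- An injective linear map is bounded below, so the size of `x` is controlled by that of `Φ x`,
hence by the level of `Φ x`, which is `m` times that of `x`. -/
theorem LinearlyBounded.comap {S : Set (Lat n)} {C : ℕ} (hC : LinearlyBounded S C) {q : ℕ}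
    {Φ : Lat q →+ Lat n} (hm : 0 < levelIndex S) (hinj : Function.Injective (realExt Φ))
    (hl : ∀ x, (Φ x).2 = levelIndex S * x.2) : ∃ C', LinearlyBounded (Φ ⁻¹' S) C' := by
  obtain ⟨κ, hκ, hanti⟩ := (realExt Φ).exists_antilipschitzWith (LinearMap.ker_eq_bot.2 hinj)
  obtain ⟨B, hB⟩ := exists_nat_gt (κ : ℝ)
  refine ⟨B * ((C + 1) * levelIndex S), fun x hx => ?_⟩
  obtain ⟨h1, h2⟩ := hC _ hx
  have hx2 : 0 ≤ x.2 := by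
    rw [hl] at h1
    exact nonneg_of_mul_nonneg_right h1 (by exact_mod_cast hm)
  refine ⟨hx2, fun i => ?_⟩
  have hle : ‖latIncl n (Φ x)‖ ≤ ((C + 1) * levelIndex S) * x.2 := by
    have hl' : ((Φ x).2 : ℝ) = levelIndex S * x.2 := by
      rw [hl]; push_cast; ring
    have hnn : (0 : ℝ) ≤ (Φ x).2 := by exact_mod_cast h1
    have hmul : ((C + 1) * levelIndex S : ℝ) * x.2 = C * (Φ x).2 + (Φ x).2 := by
      rw [hl']; ring
    rw [hmul, Prod.norm_def, max_le_iff]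
    constructor
    · rw [pi_norm_le_iff_of_nonneg (by positivity)]
      intro j
      have h3 : |((Φ x).1 j : ℝ)| ≤ C * (Φ x).2 := by exact_mod_cast h2 j
      simp only [latIncl, AddMonoidHom.coe_mk, ZeroHom.coe_mk, Real.norm_eq_abs]
      linarith
    · simp only [latIncl, AddMonoidHom.coe_mk, ZeroHom.coe_mk, Real.norm_eq_abs]
      rw [abs_of_nonneg hnn]
      have : (0 : ℝ) ≤ C * (Φ x).2 := by positivity
      linarith
  have hnorm : ‖latIncl q x‖ ≤ κ * ‖latIncl n (Φ x)‖ := by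
    rw [← realExt_latIncl]
    have := hanti.le_mul_dist (latIncl q x) 0
    simpa using this
  have hi : |(x.1 i : ℝ)| ≤ ‖latIncl q x‖ :=
    (norm_le_pi_norm (latIncl q x).1 i).trans (norm_fst_le _)
  have hx2' : (0 : ℝ) ≤ x.2 := by exact_mod_cast hx2
  have hfin : |(x.1 i : ℝ)| ≤ (B * ((C + 1) * levelIndex S)) * x.2 := by
    calc |(x.1 i : ℝ)| ≤ κ * ‖latIncl n (Φ x)‖ := hi.trans hnorm
      _ ≤ B * ‖latIncl n (Φ x)‖ := mul_le_mul_of_nonneg_right hB.le (norm_nonneg _)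
      _ ≤ B * (((C + 1) * levelIndex S) * x.2) := mul_le_mul_of_nonneg_left hle (by positivity)
      _ = _ := by ring
  push_cast
  exact_mod_cast hfin

theorem group_comap_eq_top {q : ℕ} {S : Set (Lat n)} {Φ : Lat q →+ Lat n}
    (hr : Φ.range = group S) (hinj : Function.Injective Φ) : group (Φ ⁻¹' S) = ⊤ := by
  have h1 : (group (Φ ⁻¹' S)).map Φ = (⊤ : AddSubgroup (Lat q)).map Φ := by
    rw [group, AddMonoidHom.map_closure, image_comap_of_le_range hr, ← AddMonoidHom.range_eq_map, hr]
    rfl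
  exact AddSubgroup.map_injective hinj h1

/-- The main properties of the Newton-Okounkov body of a semigroup, in coordinates. -/
theorem exists_isCoordinates (S : AddSubmonoid (Lat n)) {C : ℕ}
    (hC : LinearlyBounded (S : Set (Lat n)) C) (hm : 0 < levelIndex (S : Set (Lat n))) :
    ∃ Φ, IsCoordinates S Φ ∧ convexDim (body (S : Set (Lat n))) = rank₀ (S : Set (Lat n)) ∧
      ind (S : Set (Lat n)) ≠ 0 ∧
      bodyVolume (body (S : Set (Lat n))) =
        ind (S : Set (Lat n)) * volume (section₁ (Φ ⁻¹' (S : Set (Lat n)))) := by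
  obtain ⟨Φ, hinjR, hinj, hl, hr, h0⟩ := exists_coordinates hm
  have hG := group_comap_eq_top hr hinj
  obtain ⟨C', hC'⟩ := hC.comap hm hinjR hl
  have hlevinj : Function.Injective (levelMap Φ) := by
    intro x y hxy
    exact (Prod.mk.inj (hinjR (a₁ := (x, 0)) (a₂ := (y, 0)) hxy)).1
  have hbody := body_eq_image hm hr hinjR hl
  set D := section₁ (Φ ⁻¹' (S : Set (Lat n))) with hD
  have hDint : (interior D).Nonempty := by
    obtain ⟨y, hy⟩ := exists_mem_interior_span hC' hG
    have hcont : Continuous fun y : Fin (rank₀ (S : Set (Lat n))) → ℝ => ((y, 1) : Space _) := by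
      fun_prop
    refine ⟨y, (isOpen_interior.preimage hcont).subset_interior_iff.2 ?_ hy⟩
    intro y hy
    exact subset_closure (interior_subset hy)
  have hDne : D.Nonempty := hDint.mono interior_subset
  have hspan : vectorSpan ℝ (body (S : Set (Lat n))) = LinearMap.range (levelMap Φ) := by
    have hDspan : vectorSpan ℝ D = ⊤ := by
      rw [← AffineSubspace.affineSpan_eq_top_iff_vectorSpan_eq_top_of_nonempty ℝ _ _ hDne]
      exact affineSpan_eq_top_of_nonempty_interior
        (hDint.mono (interior_mono (subset_convexHull ℝ D)))
    have h1 := ((levelMap Φ).toAffineMap +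
      AffineMap.const ℝ (Fin (rank₀ (S : Set (Lat n))) → ℝ) (latIncl n (Φ (0, 1)))).map_vectorSpan
        (s := D)
    rw [hDspan, Submodule.map_top] at h1
    rw [hbody]
    refine h1.symm.trans ?_
    congr 1
    ext <;> simp
  have hind : ind (S : Set (Lat n)) =
      (AddSubgroup.closure (Set.range fun i => Φ (Pi.single i 1, 0))).relIndex
        ((LinearMap.range (levelMap Φ)).toAddSubgroup.comap (latIncl n)) := by
    rw [ind, h0, boundaryLattice_eq hm hr hG hl]
  have hli : LinearIndependent ℝ fun i => latIncl n (Φ (Pi.single i 1, 0)) := by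
    rw [Fintype.linearIndependent_iff]
    intro y hy
    rw [← levelMap_apply] at hy
    exact congrFun (hlevinj (hy.trans (map_zero _).symm))
  refine ⟨Φ, ⟨hinj, hl, hr, h0, hG, C', hC'⟩, ?_, ?_, ?_⟩
  · rw [convexDim, hspan, LinearMap.finrank_range_of_inj hlevinj, Module.finrank_fin_fun]
  · rw [hind]
    exact (integralMeasure_image hli (levelMap_apply Φ)).1
  · rw [bodyVolume, hspan, hbody, integralVolume_image hli (levelMap_apply Φ) _ hDne, hind]

/-- The lattice of integral points, and hence the index, depend only on `G₀`. -/
theorem ind_eq_of_group₀_eq {S T : AddSubmonoid (Lat n)}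
    (hS : 0 < levelIndex (S : Set (Lat n))) (hT : 0 < levelIndex (T : Set (Lat n)))
    (h : group₀ (S : Set (Lat n)) = group₀ (T : Set (Lat n))) :
    ind (S : Set (Lat n)) = ind (T : Set (Lat n)) := by
  obtain ⟨Φ, -, hinj, hl, hr, h0⟩ := exists_coordinates hS
  obtain ⟨Ψ, -, hinj', hl', hr', h0'⟩ := exists_coordinates hT
  rw [ind, ind, boundaryLattice_eq hS hr (group_comap_eq_top hr hinj) hl,
    boundaryLattice_eq hT hr' (group_comap_eq_top hr' hinj') hl', range_levelMap h0,
    range_levelMap h0', h]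

/-- `T` is allowed to be any subset of the group of `S` so that the semigroup of `Â_p` can be
counted in the coordinates of `A`. -/
theorem IsCoordinates.levelPts_comap {S : AddSubmonoid (Lat n)}
    {Φ : Lat (rank₀ (S : Set (Lat n))) →+ Lat n} (h : IsCoordinates S Φ)
    (hm : 0 < levelIndex (S : Set (Lat n))) (T : Set (Lat n)) (hT : T ⊆ group (S : Set (Lat n)))
    (k : ℕ) :
    (levelPts (Φ ⁻¹' T) k).encard = (levelPts T (levelIndex (S : Set (Lat n)) * k)).encard := by
  have hinj : Function.Injective fun z : Fin (rank₀ (S : Set (Lat n))) → ℤ => (Φ (z, (k : ℤ))).1 := by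
    intro z w hzw
    have : Φ (z, (k : ℤ)) = Φ (w, (k : ℤ)) := Prod.ext hzw (by rw [h.level, h.level])
    exact (Prod.mk.inj (h.injective this)).1
  rw [← hinj.encard_image]
  congr 1
  ext a
  constructor
  · rintro ⟨z, hz, rfl⟩
    have h1 : Φ (z, (k : ℤ)) ∈ T := hz
    have h2 : Φ (z, (k : ℤ)) = ((Φ (z, (k : ℤ))).1, ((levelIndex (S : Set (Lat n)) * k : ℕ) : ℤ)) :=
      Prod.ext rfl (by rw [h.level]; push_cast; rfl)
    rw [h2] at h1
    exact h1
  · intro ha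
    have h1 : (a, ((levelIndex (S : Set (Lat n)) * k : ℕ) : ℤ)) ∈ T := ha
    have h2 : (a, ((levelIndex (S : Set (Lat n)) * k : ℕ) : ℤ)) ∈ Φ.range := h.range_eq ▸ hT h1
    obtain ⟨⟨z, s⟩, hz⟩ := h2
    have hs : s = k := by
      have h3 := congrArg Prod.snd hz
      rw [h.level] at h3
      push_cast at h3
      exact mul_left_cancel₀ (by exact_mod_cast hm.ne') h3
    subst hs
    refine ⟨z, ?_, congrArg Prod.fst hz⟩
    change Φ (z, (k : ℤ)) ∈ T
    rw [hz]
    exact h1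

end Coordinates

/-! ### Hilbert functions of algebras of almost integral type -/

section Growth

variable {k F Γ : Type*} [Field k] [Field F] [Algebra k F]
  [AddCommGroup Γ] [LinearOrder Γ] [IsOrderedAddMonoid Γ] {n : ℕ}
  {e : Γ ≃+ (Fin n → ℤ)} {v : AddValuation F (WithTop Γ)}

/-- The semigroup of an algebra of almost integral type lies in a strictly convex cone. -/
theorem IsAlmostIntegralType.exists_linearlyBounded (e : Γ ≃+ (Fin n → ℤ))
    (htr : Algebra.trdeg k F = n) (hv : IsFaithfulOneDimLeaves k v)
    {A : Subalgebra k (Polynomial F)} (hA : IsAlmostIntegralType A) :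
    ∃ C, LinearlyBounded (semigroup e v A) C := by
  obtain ⟨hgr, B, hB, hAB⟩ := hA
  obtain ⟨L, hL, hBL⟩ := hB.exists_coeff_mem_pow
  obtain ⟨C, hC⟩ := exists_abs_latVal_pow_le e htr hv L
  have key : ∀ s ∈ semigroup e v A, 0 ≤ s.2 ∧ ∀ i, |s.1 i| ≤ C * (s.2 + 1) := by
    intro s hs
    obtain ⟨i, f, hf, hf0, rfl⟩ := (mem_semigroup_iff hgr).1 hs
    refine ⟨Int.natCast_nonneg i, fun j => ?_⟩
    have h1 := hBL _ (hAB (mem_coeffSpace.1 hf)) i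
    rw [Polynomial.coeff_monomial_same] at h1
    have := hC (i + 1) f h1 hf0 j
    push_cast at this
    exact this
  -- The additive constant in `C * (s.2 + 1)` is removed by applying the bound to the multiple `(C +
  -- 1) • s`: if `|s.1 i|` exceeded `C * s.2` by at least `1`, the left side would gain `C + 1` but
  -- the right side only allows `C`.
  refine ⟨C, fun s hs => ⟨(key s hs).1, fun i => ?_⟩⟩
  have h1 := (key _ ((valueMonoid e v A hgr).nsmul_mem hs (C + 1))).2 i
  have h2 : ((C + 1) • s : Lat n).1 i = (C + 1 : ℕ) * s.1 i := by
    rw [Prod.smul_fst, Pi.smul_apply, nsmul_eq_mul]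
  have h3 : ((C + 1) • s : Lat n).2 = (C + 1 : ℕ) * s.2 := by
    rw [Prod.smul_snd, nsmul_eq_mul]
  rw [h2, h3, abs_mul, Nat.abs_cast] at h1
  push_cast at h1
  by_contra hlt
  have h4 : (C : ℤ) * s.2 + 1 ≤ |s.1 i| := by linarith [Int.add_one_le_iff.2 (not_le.1 hlt)]
  have h5 := mul_le_mul_of_nonneg_left h4 (by positivity : (0 : ℤ) ≤ C + 1)
  nlinarith

theorem LinearlyBounded.finite_levelPts {S : Set (Lat n)} {C : ℕ} (h : LinearlyBounded S C)
    (i : ℕ) : (levelPts S i).Finite := by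
  refine (Set.finite_Icc (fun _ => -((C : ℤ) * i)) (fun _ => (C : ℤ) * i)).subset ?_
  intro z hz
  exact ⟨fun j => (abs_le.1 ((h _ hz).2 j)).1, fun j => (abs_le.1 ((h _ hz).2 j)).2⟩

theorem hilbert_eq_encard_levelPts (hv : IsFaithfulOneDimLeaves k v)
    {A : Subalgebra k (Polynomial F)} (hA : IsGraded A) {C : ℕ}
    (hC : LinearlyBounded (semigroup e v A) C) (i : ℕ) :
    hilbert A i = (levelPts (semigroup e v A) i).encard :=
  hilbert_eq_encard hv hA (hC.finite_levelPts i)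

theorem semigroup_mono {A B : Subalgebra k (Polynomial F)} (h : A ≤ B) :
    semigroup e v A ⊆ semigroup e v B := by
  rintro _ ⟨P, ⟨hP, hP0⟩, rfl⟩
  exact ⟨P, ⟨h hP, hP0⟩, rfl⟩

/-- The Hilbert function of a graded algebra whose semigroup lies in a strictly convex cone. -/
theorem hasGrowthCoeff_hilbert (hv : IsFaithfulOneDimLeaves k v)
    {A : Subalgebra k (Polynomial F)} (hA : IsGraded A) {C : ℕ}
    (hC : LinearlyBounded (semigroup e v A) C) (hm : 0 < levelIndex (semigroup e v A)) :
    HasGrowthCoeff (convexDim (body (semigroup e v A)))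
      (fun j => (hilbert A (levelIndex (semigroup e v A) * j) : ℝ≥0∞))
      (bodyVolume (body (semigroup e v A)) / (ind (semigroup e v A) : ℝ≥0∞)) ∧
    bodyVolume (body (semigroup e v A)) ≠ ∞ ∧ ind (semigroup e v A) ≠ 0 := by
  obtain ⟨Φ, hΦ, hdim, hind, hvol⟩ := exists_isCoordinates (valueMonoid e v A hA) hC hm
  simp only [coe_valueMonoid] at hdim hind hvol
  obtain ⟨C', hC'⟩ := hΦ.bounded
  have hgrowth := hasGrowthCoeff_levelPts ((valueMonoid e v A hA).comap Φ) hC' hΦ.group_comap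
  have hind' : (ind (semigroup e v A) : ℝ≥0∞) ≠ 0 := by exact_mod_cast hind
  refine ⟨?_, ?_, hind⟩
  · rw [hdim, hvol, mul_comm, ENNReal.mul_div_cancel_right hind' (ENNReal.natCast_ne_top _)]
    refine hgrowth.congr fun j => ?_
    beta_reduce
    rw [hilbert_eq_encard_levelPts hv hA hC]
    exact congrArg (fun x : ℕ∞ => (x : ℝ≥0∞) / (j : ℝ≥0∞) ^ rank₀ (semigroup e v A))
      (hΦ.levelPts_comap hm _ AddSubgroup.subset_closure j)
  · rw [hvol]
    exact ENNReal.mul_ne_top (ENNReal.natCast_ne_top _)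
      (hC'.isCompact_section₁).measure_lt_top.ne

end Growth

/-! ### The subalgebra generated by one homogeneous component -/

section LevelAlgebra

variable {k F : Type*} [Field k] [Field F] [Algebra k F]

theorem levelAlgebra_le (A : Subalgebra k (Polynomial F)) (p : ℕ) : levelAlgebra A p ≤ A :=
  Algebra.adjoin_le fun _ hf => hf.1

/-- The elements of `Â_p` have homogeneous parts in `Â_p`, and only in degrees divisible by `p`. -/
theorem levelAlgebra_coeff {A : Subalgebra k (Polynomial F)} {p : ℕ} {f : Polynomial F}
    (hf : f ∈ levelAlgebra A p) (i : ℕ) :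
    Polynomial.monomial i (f.coeff i) ∈ levelAlgebra A p ∧ (f.coeff i ≠ 0 → p ∣ i) := by
  induction hf using Algebra.adjoin_induction generalizing i with
  | mem f hf =>
    obtain ⟨a, ha⟩ := hf.2
    have hfa : f = Polynomial.monomial p a := ha.symm
    by_cases hi : i = p
    · subst hi
      refine ⟨Algebra.subset_adjoin ?_, fun _ => dvd_rfl⟩
      rwa [hfa, Polynomial.coeff_monomial_same, ← hfa]
    · have h0 : f.coeff i = 0 := by rw [hfa, Polynomial.coeff_monomial_of_ne _ hi]
      rw [h0, Polynomial.monomial_zero_right]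
      exact ⟨zero_mem _, fun h => absurd rfl h⟩
  | algebraMap c =>
    rw [Polynomial.algebraMap_apply, Polynomial.coeff_C]
    split_ifs with hi
    · subst hi
      refine ⟨?_, fun _ => dvd_zero p⟩
      have := (levelAlgebra A p).algebraMap_mem c
      rwa [Polynomial.algebraMap_apply] at this
    · rw [Polynomial.monomial_zero_right]
      exact ⟨zero_mem _, fun h => absurd rfl h⟩
  | add f g _ _ hf hg =>
    rw [Polynomial.coeff_add, map_add]
    refine ⟨add_mem (hf i).1 (hg i).1, fun h => ?_⟩
    by_cases h0 : f.coeff i = 0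
    · exact (hg i).2 (by simpa [h0] using h)
    · exact (hf i).2 h0
  | mul f g _ _ hf hg =>
    rw [Polynomial.coeff_mul, map_sum]
    constructor
    · refine sum_mem fun x hx => ?_
      rw [← Finset.HasAntidiagonal.mem_antidiagonal.1 hx, ← Polynomial.monomial_mul_monomial]
      exact mul_mem (hf _).1 (hg _).1
    · intro h
      obtain ⟨x, hx, hx0⟩ := Finset.exists_ne_zero_of_sum_ne_zero h
      rw [← Finset.HasAntidiagonal.mem_antidiagonal.1 hx]
      exact dvd_add ((hf _).2 (left_ne_zero_of_mul hx0)) ((hg _).2 (right_ne_zero_of_mul hx0))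

theorem isGraded_levelAlgebra (A : Subalgebra k (Polynomial F)) (p : ℕ) :
    IsGraded (levelAlgebra A p) := fun _ hf i => (levelAlgebra_coeff hf i).1

theorem coeffSpace_le_levelAlgebra (A : Subalgebra k (Polynomial F)) (p : ℕ) :
    coeffSpace A p ≤ coeffSpace (levelAlgebra A p) p := fun f hf =>
  mem_coeffSpace.2 (Algebra.subset_adjoin ⟨mem_coeffSpace.1 hf, f, rfl⟩)

end LevelAlgebra

theorem HasGrowthCoeff.comp_mul {q : ℕ} {f : ℕ → ℝ≥0∞} {a : ℝ≥0∞} (h : HasGrowthCoeff q f a)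
    {j : ℕ} (hj : 0 < j) :
    HasGrowthCoeff q (fun t => f (t * j)) ((j : ℝ≥0∞) ^ q * a) := by
  have hjq0 : (j : ℝ≥0∞) ^ q ≠ 0 := pow_ne_zero _ (by exact_mod_cast hj.ne')
  have hjq : (j : ℝ≥0∞) ^ q ≠ ∞ := ENNReal.pow_ne_top (ENNReal.natCast_ne_top _)
  have h1 : Tendsto (fun t : ℕ => t * j) atTop atTop := tendsto_id.atTop_mul_const' hj
  have h2 := ENNReal.Tendsto.const_mul (Tendsto.comp h h1) (Or.inr hjq) (a := (j : ℝ≥0∞) ^ q)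
  refine h2.congr fun t => ?_
  simp only [Function.comp_apply]
  push_cast
  rw [mul_pow, mul_comm ((t : ℝ≥0∞) ^ q), ← mul_div_assoc, ENNReal.mul_div_mul_left _ _ hjq0 hjq]

/-! ### Comparison of the semigroups of `Â_p` and `A` -/

section Fujita

variable {k F Γ : Type*} [Field k] [Field F] [Algebra k F]
  [AddCommGroup Γ] [LinearOrder Γ] [IsOrderedAddMonoid Γ] {n : ℕ}
  {e : Γ ≃+ (Fin n → ℤ)} {v : AddValuation F (WithTop Γ)}

theorem mem_semigroup_levelAlgebra {A : Subalgebra k (Polynomial F)} (hA : IsGraded A) {p : ℕ}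
    {z : Lat n} (hz : z ∈ semigroup e v A) (hz2 : z.2 = p) :
    z ∈ semigroup e v (levelAlgebra A p) := by
  obtain ⟨a, s⟩ := z
  obtain rfl : s = p := hz2
  obtain ⟨f, hf, hf0, hfa⟩ := (mk_mem_semigroup_iff hA).1 hz
  exact (mk_mem_semigroup_iff (isGraded_levelAlgebra A p)).2
    ⟨f, coeffSpace_le_levelAlgebra A p hf, hf0, hfa⟩

/-- Only degrees divisible by `p` occur in `Â_p`, and degree `p` does occur. Thus the growth theorem
for `Â_p` concerns exactly the degrees `t * p`. -/
theorem levelIndex_levelAlgebra {A : Subalgebra k (Polynomial F)} {p : ℕ} {z : Lat n}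
    (hz : z ∈ semigroup e v (levelAlgebra A p)) (hz2 : z.2 = p) :
    levelIndex (semigroup e v (levelAlgebra A p)) = p := by
  apply Nat.dvd_antisymm
  · have := levelIndex_dvd (AddSubgroup.subset_closure hz : z ∈ group _)
    rw [hz2] at this
    exact_mod_cast this
  · have h1 : (levelIndex (semigroup e v (levelAlgebra A p)) : ℤ) ∈
        (group (semigroup e v (levelAlgebra A p))).map (AddMonoidHom.snd (Fin n → ℤ) ℤ) := by
      rw [map_snd_group]; exact AddSubgroup.mem_zmultiples _
    obtain ⟨g, hg, hg2⟩ := h1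
    have h2 : group (semigroup e v (levelAlgebra A p)) ≤
        (AddSubgroup.zmultiples (p : ℤ)).comap (AddMonoidHom.snd (Fin n → ℤ) ℤ) := by
      refine (AddSubgroup.closure_le _).2 fun s hs => ?_
      obtain ⟨i, f, hf, hf0, rfl⟩ := (mem_semigroup_iff (isGraded_levelAlgebra A p)).1 hs
      have h3 := (levelAlgebra_coeff (mem_coeffSpace.1 hf) i).2
        (by rwa [Polynomial.coeff_monomial_same])
      exact Int.mem_zmultiples_iff.2 (Int.natCast_dvd_natCast.2 h3)
    have h4 := Int.mem_zmultiples_iff.1 (h2 hg)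
    rw [hg2] at h4
    exact_mod_cast h4

/-- High levels of a graded algebra generate subalgebras with the same group `G₀`. -/
theorem IsCoordinates.group₀_levelAlgebra {A : Subalgebra k (Polynomial F)} (hA : IsGraded A)
    {Φ : Lat (rank₀ (semigroup e v A)) →+ Lat n}
    (hΦ : IsCoordinates (n := n) (valueMonoid e v A hA) Φ) {p : ℕ} {s : ℤ}
    (hs : levelIndex (semigroup e v A) * s = p) {z : Fin (rank₀ (semigroup e v A)) → ℤ}
    (hz : Φ (z, s) ∈ semigroup e v A)
    (hz' : ∀ i, Φ (z + Pi.single i 1, s) ∈ semigroup e v A) :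
    group₀ (semigroup e v (levelAlgebra A p)) = group₀ (semigroup e v A) := by
  apply le_antisymm
  · exact inf_le_inf_right _ (AddSubgroup.closure_mono (semigroup_mono (levelAlgebra_le A p)))
  · have hlev : ∀ y, (Φ (y, s)).2 = p := fun y => (hΦ.level _).trans hs
    refine hΦ.closure_range.symm.le.trans ((AddSubgroup.closure_le _).2 ?_)
    rintro _ ⟨(i : Fin (rank₀ (semigroup e v A))), rfl⟩
    refine mem_group₀.2 ⟨?_, by rw [hΦ.level]; simp⟩
    change Φ (Pi.single i 1, 0) ∈ _
    -- A basis vector of `G₀` is the difference of two values at level `p`, both of which are values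
    -- of `Â_p`.
    have h1 : Φ (Pi.single i 1, 0) = Φ (z + Pi.single i 1, s) - Φ (z, s) := by
      rw [← map_sub]; simp
    rw [h1]
    exact sub_mem
      (AddSubgroup.subset_closure (mem_semigroup_levelAlgebra hA (hz' i) (hlev _)))
      (AddSubgroup.subset_closure (mem_semigroup_levelAlgebra hA hz (hlev _)))

end Fujita

end NewtonOkounkov

/-! ### The approximation theorem -/

theorem mainTheorem5 {k F Γ : Type*} [Field k] [Field F] [Algebra k F]
    [AddCommGroup Γ] [LinearOrder Γ] [IsOrderedAddMonoid Γ]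
    (n : ℕ) (htr : Algebra.trdeg k F = n)
    (e : Γ ≃+ (Fin n → ℤ)) (v : AddValuation F (WithTop Γ)) (hv : IsFaithfulOneDimLeaves k v)
    (A : Subalgebra k (Polynomial F)) (hA : IsAlmostIntegralType A)
    (hpos : ∃ i : ℕ, 0 < i ∧ component A i ≠ ⊥)
    (q m : ℕ) (hq : q = convexDim (body (semigroup e v A)))
    (hm : m = levelIndex (semigroup e v A)) :
    (∀ᶠ p : ℕ in atTop, m ∣ p →
      component A p ≠ ⊥ ∧
      convexDim (body (semigroup e v (levelAlgebra A p))) = q ∧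
      ind (semigroup e v (levelAlgebra A p)) = ind (semigroup e v A)) ∧
    bodyVolume (body (semigroup e v A)) ≠ ∞ ∧ ind (semigroup e v A) ≠ 0 ∧
    ∃ φ : ℕ → ℝ≥0,
      (∀ᶠ p : ℕ in atTop, m ∣ p →
        HasGrowthCoeff q (fun t => (hilbert (levelAlgebra A p) (t * p) : ℝ≥0∞)) (φ p)) ∧
      HasGrowthCoeff q (fun j => (φ (m * j) : ℝ≥0∞))
        (bodyVolume (body (semigroup e v A)) / (ind (semigroup e v A) : ℝ≥0∞)) ∧
      HasGrowthCoeff q (fun j => (hilbert A (m * j) : ℝ≥0∞))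
        (bodyVolume (body (semigroup e v A)) / (ind (semigroup e v A) : ℝ≥0∞)) := by
  have hgr : IsGraded A := hA.1
  obtain ⟨C, hC⟩ := hA.exists_linearlyBounded e htr hv
  have hmpos : 0 < m := by
    obtain ⟨i, hi, hne⟩ := hpos
    rw [Ne, component_eq_bot_iff] at hne
    obtain ⟨f, hf, hf0⟩ := Submodule.exists_mem_ne_zero_of_ne_bot hne
    rw [hm]
    exact levelIndex_pos ((mk_mem_semigroup_iff (e := e) (v := v) hgr).2 ⟨f, hf, hf0, rfl⟩)
      (Int.natCast_ne_zero.2 hi.ne')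
  have hm' : 0 < levelIndex (semigroup e v A) := hm ▸ hmpos
  obtain ⟨hgrowth, hfin, hind⟩ := hasGrowthCoeff_hilbert hv hgr hC hm'
  rw [← hq, ← hm] at hgrowth
  obtain ⟨Φ, hΦ, hdim, -, hvol⟩ := exists_isCoordinates (valueMonoid e v A hgr) hC hm'
  simp only [coe_valueMonoid] at hdim hvol
  have hind' : (ind (semigroup e v A) : ℝ≥0∞) ≠ 0 := by exact_mod_cast hind
  obtain ⟨C', hC'⟩ := hΦ.bounded
  set V := bodyVolume (body (semigroup e v A)) / (ind (semigroup e v A) : ℝ≥0∞) with hV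
  have hVvol : volume (section₁ (Φ ⁻¹' (semigroup e v A))) = V := by
    rw [hV, hvol, mul_comm]
    exact (ENNReal.mul_div_cancel_right hind' (ENNReal.natCast_ne_top _)).symm
  have hVtop : V ≠ ∞ := ENNReal.div_ne_top hfin hind'
  have hbdd : ∀ p, LinearlyBounded (semigroup e v (levelAlgebra A p)) C := fun p s hs =>
    hC s (semigroup_mono (levelAlgebra_le A p) hs)
  obtain ⟨j₀, hj₀⟩ := exists_mem_and_add_single_mem ((valueMonoid e v A hgr).comap Φ) hC'
    hΦ.group_comap
  have hlevel : ∀ j : ℕ, levelIndex (semigroup e v A) * (j : ℤ) = ((m * j : ℕ) : ℤ) := by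
    intro j; rw [hm]; push_cast; rfl
  have hΦ2 : ∀ (z) (j : ℕ), (Φ (z, (j : ℤ))).2 = ((m * j : ℕ) : ℤ) := fun z j =>
    (hΦ.level _).trans (hlevel j)
  have hmain : ∀ j ≥ max j₀ 1, component A (m * j) ≠ ⊥ ∧
      convexDim (body (semigroup e v (levelAlgebra A (m * j)))) = q ∧
      ind (semigroup e v (levelAlgebra A (m * j))) = ind (semigroup e v A) ∧
      levelIndex (semigroup e v (levelAlgebra A (m * j))) = m * j := by
    intro j hj
    obtain ⟨z, hz, hz'⟩ := hj₀ j (le_of_max_le_left hj)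
    have hzS : Φ (z, (j : ℤ)) ∈ semigroup e v A := hz
    have hlev := levelIndex_levelAlgebra (mem_semigroup_levelAlgebra hgr hzS (hΦ2 z j)) (hΦ2 z j)
    have hpos' : 0 < levelIndex (semigroup e v (levelAlgebra A (m * j))) := by
      rw [hlev]
      exact Nat.mul_pos hmpos (lt_of_lt_of_le one_pos (le_of_max_le_right hj))
    have hG₀ := hΦ.group₀_levelAlgebra hgr (hlevel j) hzS hz'
    obtain ⟨-, -, hdim', -, -⟩ := exists_isCoordinates
      (valueMonoid e v _ (isGraded_levelAlgebra A (m * j))) (hbdd _) hpos'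
    refine ⟨?_, ?_, ?_, hlev⟩
    · rw [Ne, component_eq_bot_iff]
      intro hbot
      have h1 : ((Φ (z, (j : ℤ))).1, ((m * j : ℕ) : ℤ)) ∈ semigroup e v A := by
        rw [← hΦ2 z j]; exact hzS
      obtain ⟨f, hf, hf0, -⟩ := (mk_mem_semigroup_iff hgr).1 h1
      rw [hbot] at hf
      exact hf0 hf
    · rw [hq, hdim]
      simp only [coe_valueMonoid] at hdim'
      rw [hdim', rank₀, rank₀, hG₀]
    · exact ind_eq_of_group₀_eq (S := valueMonoid e v _ (isGraded_levelAlgebra A (m * j)))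
        (T := valueMonoid e v A hgr) hpos' hm' hG₀
  have hev : ∀ {P : ℕ → Prop} (N : ℕ), (∀ j ≥ N, P (m * j)) → ∀ᶠ p : ℕ in atTop, m ∣ p → P p := by
    intro P N hP
    filter_upwards [eventually_ge_atTop (m * N)] with p hp
    rintro ⟨j, rfl⟩
    exact hP j (Nat.le_of_mul_le_mul_left hp hmpos)
  -- The limit predicted by the growth theorem for `Â_p`. Its value matters only for large multiples
  -- of `m`, where the quotient is finite and `toNNReal` loses nothing.
  set φ : ℕ → ℝ≥0 := fun p => (bodyVolume (body (semigroup e v (levelAlgebra A p))) /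
    (ind (semigroup e v (levelAlgebra A p)) : ℝ≥0∞)).toNNReal with hφ
  have hφgrowth : ∀ j ≥ max j₀ 1, HasGrowthCoeff q
      (fun t => (hilbert (levelAlgebra A (m * j)) (t * (m * j)) : ℝ≥0∞)) (φ (m * j)) := by
    intro j hj
    obtain ⟨-, h2, -, h4⟩ := hmain j hj
    have hpos' : 0 < levelIndex (semigroup e v (levelAlgebra A (m * j))) := by
      rw [h4]
      exact Nat.mul_pos hmpos (lt_of_lt_of_le one_pos (le_of_max_le_right hj))
    obtain ⟨hg, hf, hi⟩ := hasGrowthCoeff_hilbert hv (isGraded_levelAlgebra A (m * j))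
      (hbdd (m * j)) hpos'
    have hi' : (ind (semigroup e v (levelAlgebra A (m * j))) : ℝ≥0∞) ≠ 0 := by exact_mod_cast hi
    rw [hφ]
    simp only
    rw [ENNReal.coe_toNNReal (ENNReal.div_ne_top hf hi')]
    rw [h2, h4] at hg
    simpa only [mul_comm (m * j)] using hg
  refine ⟨hev _ fun j hj => ⟨(hmain j hj).1, (hmain j hj).2.1, (hmain j hj).2.2.1⟩, hfin, hind, φ,
    hev _ hφgrowth, ?_, hgrowth⟩
  -- Squeeze `φ(mj) / j ^ q` for large `j` between the constants `r ^ q * V` and `V`.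
  refine tendsto_of_forall_ratio (d := q) hVtop ?_ tendsto_const_nhds ?_
  · intro r hr0 hr1
    obtain ⟨K, hK, hKc, -, hKvol, p₀, hp₀⟩ := exists_inner_approximation
      ((valueMonoid e v A hgr).comap Φ) hC' hΦ.group_comap hr0 hr1
    refine ⟨fun _ => ENNReal.ofReal (r ^ q) * V, tendsto_const_nhds, ?_⟩
    filter_upwards [eventually_ge_atTop (max (max j₀ 1) p₀)] with j hj
    have hj1 : 0 < j := lt_of_lt_of_le one_pos (le_of_max_le_right (le_of_max_le_left hj))
    have hg := hφgrowth j (le_of_max_le_left hj)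
    have hl : HasGrowthCoeff q (fun t => ((latPts K (t * j)).encard : ℝ≥0∞))
        ((j : ℝ≥0∞) ^ q * (ENNReal.ofReal (r ^ q) * V)) := by
      have h := (hasGrowthCoeff_latPts hK hKc).comp_mul hj1
      rw [hKvol] at h
      rw [hq, hdim, ← hVvol]
      exact h
    -- With `j` fixed, let `t → ∞`: the lattice points of `(t * j) K` are values of `Â_{mj}` in
    -- degree `t * m * j`, so their growth coefficient `j ^ q * r ^ q * V` is at most `φ(mj)`.
    have hle := le_of_tendsto_of_tendsto hl hg (by
      filter_upwards [eventually_gt_atTop 0] with t ht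
      refine ENNReal.div_le_div_right ?_ _
      rw [hilbert_eq_encard_levelPts hv (isGraded_levelAlgebra A (m * j)) (hbdd (m * j)),
        show t * (m * j) = levelIndex (semigroup e v A) * (t * j) by rw [← hm]; ring]
      have h1 := hΦ.levelPts_comap hm' (semigroup e v (levelAlgebra A (m * j)))
        ((semigroup_mono (levelAlgebra_le A (m * j))).trans AddSubgroup.subset_closure) (t * j)
      simp only [coe_valueMonoid] at h1
      rw [← h1]
      refine encard_ennreal_mono ((hp₀ j (le_of_max_le_right hj) t ht).trans ?_)
      have h2 : AddSubmonoid.closure {s : Lat _ | s ∈ (valueMonoid e v A hgr).comap Φ ∧ s.2 = j} ≤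
          (valueMonoid e v _ (isGraded_levelAlgebra A (m * j))).comap Φ := by
        rw [AddSubmonoid.closure_le]
        rintro ⟨z, s⟩ ⟨hs, hs2⟩
        obtain rfl : s = j := hs2
        exact mem_semigroup_levelAlgebra hgr hs (hΦ2 z j)
      exact fun z hz => h2 hz)
    rw [ENNReal.le_div_iff_mul_le (Or.inl (pow_ne_zero _ (by exact_mod_cast hj1.ne')))
      (Or.inl (ENNReal.pow_ne_top (ENNReal.natCast_ne_top _))), mul_comm]
    exact hle
  · filter_upwards [eventually_ge_atTop (max j₀ 1)] with j hj
    have hj1 : 0 < j := lt_of_lt_of_le one_pos (le_of_max_le_right hj)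
    -- The same limit in `t` applied to `Â_{mj} ≤ A`; sampling the Hilbert function of `A` at every
    -- `j`-th multiple of `m` gives the factor `j ^ q`.
    have hle := le_of_tendsto_of_tendsto (hφgrowth j hj) (hgrowth.comp_mul hj1)
      (Eventually.of_forall fun t => ENNReal.div_le_div_right (by
        simp only
        rw [show t * (m * j) = m * (t * j) by ring]
        exact ENat.toENNReal_mono (hilbert_mono (levelAlgebra_le A (m * j)) _)) _)
    exact ENNReal.div_le_of_le_mul (hle.trans_eq (mul_comm _ _))
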